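/- A quadrilateral is a simple quadrilateral in the Euclidean plane (convex or not, with no straight angle) whose vertices are labelled $0,1,2,3$ in cyclic order; its edge $i$ joins vertex $i$ to vertex $i+1 \pmod 4$. Let $\mathcal{Q}$ be the space of quadrilaterals up to similarity of labelled figures (reflections allowed), with the quotient of the topology given by the vertex coordinates, and let $\mathcal{R}\subset\mathcal{Q}$ be the set of rectangles (the rectangle line). A periodic billiard path never hits a vertex. For a nonempty word $W$ of even length $n$ in the letters $0,1,2,3$, the orbit tile $O(W)\subset\mathcal{Q}$ is the set of all quadrilaterals having a periodic billiard path of orbit type $W$, i.e. a billiard path that closes up after $n$ bounces (not necessarily for the first time) and successively hits the edges named by the letters of $W$. (a) For every rectangle $r\in\mathcal{Q}$ there is an open set $U\subset\mathcal{Q}$ containing $r$ such that every quadrilateral in $U$ has a periodic billiard path. (b) There are an open set $U\subset\mathcal{Q}$ with $\mathcal{R}\subset U$ and a finite set $\mathcal{F}$ of words such that $U\subset\bigcup_{W\in\mathcal{F}}O(W)$. Moreover, every $W\in\mathcal{F}$ can be taken to be one of the following eight words, up to a relabelling of the edges by one of the eight symmetries $i\mapsto a+i$, $i\mapsto a-i$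 of $\mathbb{Z}/4$: \[ \begin{array}{ll} F: & 012012,\\ R: & 012021,\\ A: & 01203213,\\ X_2: & 0(13)^2013131310(31)^203,\\ X_3: & 0(13)^30(13)^2131(31)^20(31)^303,\\ Y_2: & 01313103,\\ Y_3: & 0131313103,\\ \text{bouncing orbit}: & 0202. \end{array} \] -/

import Mathlib

open scoped Similar

namespace QuadBilliard

/-- Four points of the Euclidean plane `ℂ`, in cyclic order, are the vertices of a quadrilateral
if no three consecutive ones are collinear and one of the two diagonals splits the figure into
two triangles lying strictly on opposite sides of it. These are exactly the simple
(convex or non-convex) quadrilaterals without a straight angle. -/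
def IsQuadrilateral (v : Fin 4 → ℂ) : Prop :=
  (∀ i : Fin 4, ¬ Collinear ℝ {v i, v (i + 1), v (i + 2)}) ∧
    ((line[ℝ, v 0, v 2]).SOppSide (v 1) (v 3) ∨ (line[ℝ, v 1, v 3]).SOppSide (v 0) (v 2))

/-- Quadrilaterals with labelled vertices, topologized as a subspace of `ℂ⁴`.
Edge number `i` joins vertex `i` to vertex `i + 1` (cyclically). -/
abbrev Quadrilateral : Type := {v : Fin 4 → ℂ // IsQuadrilateral v}

/-- Similarity of labelled quadrilaterals (orientation may be reversed). -/
instance similaritySetoid : Setoid Quadrilateral where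
  r P Q := P.1 ∼ Q.1
  iseqv := ⟨fun P => Similar.refl P.1, fun h => Similar.symm h, fun h h' => Similar.trans h h'⟩

/-- The space of quadrilaterals up to similarity, with the quotient topology. -/
abbrev QuadSpace : Type := Quotient similaritySetoid

namespace Quadrilateral

/-- All four angles are right angles. -/
def IsRectangle (P : Quadrilateral) : Prop :=
  ∀ i : Fin 4, EuclideanGeometry.angle (P.1 i) (P.1 (i + 1)) (P.1 (i + 2)) = Real.pi / 2

/-- The relative interior of edge number `i` (vertices are excluded). -/
def openEdge (P : Quadrilateral) (i : Fin 4) : Set ℂ :=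
  openSegment ℝ (P.1 i) (P.1 (i + 1))

/-- The closed billiard table bounded by the quadrilateral: the union of the two triangles into
which it is split by a diagonal separating the other two vertices. (If both diagonals do, the
quadrilateral is convex and the two unions coincide.) -/
def table (P : Quadrilateral) : Set ℂ :=
  {x | ((line[ℝ, P.1 0, P.1 2]).SOppSide (P.1 1) (P.1 3) ∧
        (x ∈ convexHull ℝ {P.1 0, P.1 1, P.1 2} ∨ x ∈ convexHull ℝ {P.1 2, P.1 3, P.1 0})) ∨
      ((line[ℝ, P.1 1, P.1 3]).SOppSide (P.1 0) (P.1 2) ∧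
        (x ∈ convexHull ℝ {P.1 1, P.1 2, P.1 3} ∨ x ∈ convexHull ℝ {P.1 3, P.1 0, P.1 1}))}

/-- A billiard path in the quadrilateral: the ball successively hits the edges
`s 0, s 1, s 2, …` at the points `p 0, p 1, p 2, …`, never at a vertex; between two consecutive
bounces it moves on a straight line inside the table; at each bounce the direction of motion is
reflected in the edge that is hit. -/
structure IsBilliardPath (P : Quadrilateral) (s : ℕ → Fin 4) (p : ℕ → ℂ) : Prop where
  mem_edge : ∀ k, p k ∈ P.openEdge (s k)
  inside : ∀ k, openSegment ℝ (p k) (p (k + 1)) ⊆ interior P.table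
  reflect : ∀ k, SameRay ℝ
    ((Submodule.span ℝ {P.1 (s (k + 1) + 1) - P.1 (s (k + 1))}).reflection (p (k + 1) - p k))
    (p (k + 2) - p (k + 1))

/-- There is a billiard path that repeats itself over and over again. -/
def HasPeriodicBilliardPath (P : Quadrilateral) : Prop :=
  ∃ (s : ℕ → Fin 4) (p : ℕ → ℂ) (n : ℕ), 0 < n ∧ P.IsBilliardPath s p ∧ ∀ k, p (k + n) = p k

/-- The quadrilateral has a periodic billiard path of orbit type `W`: `W` is a nonempty word of
even length, and the path closes up after `W.length` bounces, hitting the edges in the order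
prescribed by the letters of `W`. (A path that already closes up after an odd number of bounces
is run through twice, so that its orbit type is a square.) -/
def HasOrbitType (P : Quadrilateral) (W : List (Fin 4)) : Prop :=
  W ≠ [] ∧ Even W.length ∧ ∃ (s : ℕ → Fin 4) (p : ℕ → ℂ), P.IsBilliardPath s p ∧
    (∀ k, p (k + W.length) = p k) ∧ ∀ k, W[k % W.length]? = some (s k)

end Quadrilateral

/-- The set of (similarity classes of) rectangles: the rectangle line. -/
def rectangles : Set QuadSpace :=
  {q | ∃ P : Quadrilateral, P.IsRectangle ∧ (⟦P⟧ : QuadSpace) = q}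

/-- The orbit tile of `W`: all quadrilaterals, up to similarity, with a periodic billiard path of
orbit type `W`. -/
def orbitTile (W : List (Fin 4)) : Set QuadSpace :=
  {q | ∀ P : Quadrilateral, (⟦P⟧ : QuadSpace) = q → P.HasOrbitType W}

/-- The orbit types of the orbits F, R, A, X₂, X₃, Y₂, Y₃ and of the bouncing orbit. -/
def basicOrbitTypes : List (List (Fin 4)) :=
  [[0, 1, 2, 0, 1, 2],
   [0, 1, 2, 0, 2, 1],
   [0, 1, 2, 0, 3, 2, 1, 3],
   [0, 1, 3, 1, 3, 0, 1, 3, 1, 3, 1, 3, 1, 0, 3, 1, 3, 1, 0, 3],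
   [0, 1, 3, 1, 3, 1, 3, 0, 1, 3, 1, 3, 1, 3, 1, 3, 1, 3, 1, 0, 3, 1, 3, 1, 3, 1, 0, 3],
   [0, 1, 3, 1, 3, 1, 0, 3],
   [0, 1, 3, 1, 3, 1, 3, 1, 0, 3],
   [0, 2, 0, 2]]

/-- `W` arises from `V` by one of the eight symmetries of the cyclically labelled edges. -/
def IsRelabelling (W V : List (Fin 4)) : Prop :=
  ∃ a : Fin 4, W = V.map (fun i => a + i) ∨ W = V.map (fun i => a - i)

end QuadBilliard

namespace QuadBilliard

/-! Near a rectangle all four angles are close to π/2, and they add up to 2π. If all are right, a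
ball bounces between two opposite edges. Otherwise some angle is acute. If the opposite angle is
acute too, a closed path of type A runs along the diagonal joining these two corners
(`IsDiagonalFrame.hasBasicPath`). If it is not, the two remaining angles together exceed π by at
most the deficit of the acute one, so one of them exceeds π/2 by at most half of that deficit. After
a relabelling the angles at vertices 0 and 1 are π/2 - A and π/2 + B with A > 0 and 2B ≤ A
(`hasBasicPath_of_relabellings`).

In this last case everything happens close to edge 0, where nearly horizontal lines run between
edges 3 and 1. For B < 0 the Fagnano path F closes up. For B ≥ 0 the ball starts at a right angle to
edge 3. Each slope along the way is an integral combination of A and B, so it can be arranged that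
the ball meets edge 3 or 1 at a right angle and runs back: R for B = 0, X₂ for 0 < 3B < A, Y₂ for A
= 3B, X₃ for 2B < A < 3B, Y₃ for A = 2B. The free parameter is the distance μ of the first line from
vertex 0. It has to satisfy inequalities between sums of sines, and sum-to-product identities show
that these are compatible.

Paths are computed as chains of directed lines, each given by a direction and a moment about the
origin (`Follows`). Crossing an open edge amounts to two strict inequalities, and by convexity
nothing else is needed for a billiard path (`Follows.bouncesAlong`, `BouncesAlong.hasOrbitType`).
The vertices 2 and 3 are kept out of the way of the horizontal lines by a bound κ that depends on
the rectangle alone. All conditions are invariant under similarity, so openness descends to the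
quotient. -/

open ComplexConjugate

/-! ### Determinants and mirror images of plane vectors -/

/-- The determinant of two plane vectors. -/
def cross (z w : ℂ) : ℝ := z.re * w.im - z.im * w.re

lemma cross_add_left (x y z : ℂ) : cross (x + y) z = cross x z + cross y z := by
  simp only [cross, Complex.add_re, Complex.add_im]; ring

lemma cross_sub_left (x y z : ℂ) : cross (x - y) z = cross x z - cross y z := by
  simp only [cross, Complex.sub_re, Complex.sub_im]; ring

lemma cross_sub_right (x y z : ℂ) : cross x (y - z) = cross x y - cross x z := by
  simp only [cross, Complex.sub_re, Complex.sub_im]; ring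

lemma cross_add_right (x y z : ℂ) : cross x (y + z) = cross x y + cross x z := by
  simp only [cross, Complex.add_re, Complex.add_im]; ring

lemma cross_smul_left (r : ℝ) (x y : ℂ) : cross (r • x) y = r * cross x y := by
  simp only [cross, Complex.smul_re, Complex.smul_im, smul_eq_mul]; ring

lemma cross_smul_right (r : ℝ) (x y : ℂ) : cross x (r • y) = r * cross x y := by
  simp only [cross, Complex.smul_re, Complex.smul_im, smul_eq_mul]; ring

lemma cross_neg_left (x y : ℂ) : cross (-x) y = -cross x y := by
  simp only [cross, Complex.neg_re, Complex.neg_im]; ring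

lemma cross_neg_right (x y : ℂ) : cross x (-y) = -cross x y := by
  simp only [cross, Complex.neg_re, Complex.neg_im]; ring

lemma cross_self (x : ℂ) : cross x x = 0 := by
  simp only [cross]; ring

lemma cross_swap (x y : ℂ) : cross x y = -cross y x := by
  simp only [cross]; ring

lemma cross_mul_mul (c x y : ℂ) : cross (c * x) (c * y) = Complex.normSq c * cross x y := by
  simp only [cross, Complex.mul_re, Complex.mul_im, Complex.normSq_apply]; ring

lemma cross_conj_conj (x y : ℂ) : cross (conj x) (conj y) = -cross x y := by
  simp only [cross, Complex.conj_re, Complex.conj_im]; ring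

/-- Cramer's rule. When `z` and `d` are parallel the right side vanishes and the factor between them
is a quotient of determinants, whose sign can be read off. -/
lemma cross_smul_sub_smul (e d z : ℂ) : cross e d • z - cross e z • d = cross z d • e := by
  apply Complex.ext <;>
    simp only [cross, Complex.sub_re, Complex.sub_im, Complex.smul_re, Complex.smul_im,
      smul_eq_mul] <;> ring

/-- The mirror image of the vector `d` in the line spanned by `e`. -/
noncomputable def mirror (e d : ℂ) : ℂ := e / conj e * conj d

lemma mirror_eq_smul {e : ℂ} (d : ℂ) :
    mirror e d = (Complex.normSq e)⁻¹ • (e * e * conj d) := by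
  unfold mirror
  rw [div_eq_mul_inv, Complex.inv_def, Complex.conj_conj, Complex.normSq_conj, Complex.real_smul]
  push_cast
  ring

lemma cross_mirror {e : ℂ} (he : e ≠ 0) (d : ℂ) : cross e (mirror e d) = -cross e d := by
  have h := Complex.normSq_pos.2 he
  rw [mirror_eq_smul, cross_smul_right, inv_mul_eq_iff_eq_mul₀ h.ne']
  simp only [cross, Complex.mul_re, Complex.mul_im, Complex.normSq_apply, Complex.conj_re,
    Complex.conj_im]
  ring

lemma mirror_mirror {e : ℂ} (he : e ≠ 0) (d : ℂ) : mirror e (mirror e d) = d := by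
  have h : conj e ≠ 0 := (map_ne_zero _).2 he
  unfold mirror
  rw [map_mul, map_div₀, Complex.conj_conj, Complex.conj_conj]
  field_simp

lemma mirror_neg (e d : ℂ) : mirror e (-d) = -mirror e d := by
  simp [mirror]

lemma mirror_smul (e : ℂ) (r : ℝ) (d : ℂ) : mirror e (r • d) = r • mirror e d := by
  simp only [mirror, Complex.real_smul, map_mul, Complex.conj_ofReal]; ring

lemma reflection_eq_mirror {e : ℂ} (he : e ≠ 0) (d : ℂ) :
    (Submodule.span ℝ {e}).reflection d = mirror e d := by
  have h := Complex.normSq_pos.2 he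
  have h2 : ‖e‖ ^ 2 = Complex.normSq e := (Complex.normSq_eq_norm_sq e).symm
  rw [Submodule.reflection_singleton_apply, mirror_eq_smul]
  apply Complex.ext
  · simp only [Complex.inner, RCLike.ofReal_real_eq_id, id, h2, Complex.sub_re,
      Complex.smul_re, two_smul, Complex.add_re, smul_eq_mul, Complex.mul_re, Complex.conj_re,
      Complex.conj_im, Complex.mul_im]
    field_simp
    simp only [Complex.normSq_apply]; ring
  · simp only [Complex.inner, RCLike.ofReal_real_eq_id, id, h2, Complex.sub_im,
      Complex.smul_im, two_smul, Complex.add_im, smul_eq_mul, Complex.mul_re, Complex.conj_re,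
      Complex.conj_im, Complex.mul_im]
    field_simp
    simp only [Complex.normSq_apply]; ring

/-! ### Directed lines and their bounces -/

/-- Edge number `i` of a closed polygon with four vertices, as a vector. -/
def edgeVec (V : Fin 4 → ℂ) (i : Fin 4) : ℂ := V (i + 1) - V i

/-- The directed line `{p | cross p dir = moment}`. -/
@[ext]
structure DirectedLine where
  dir : ℂ
  moment : ℝ

namespace DirectedLine

instance : Neg DirectedLine := ⟨fun L => ⟨-L.dir, -L.moment⟩⟩

@[simp] lemma neg_dir (L : DirectedLine) : (-L).dir = -L.dir := rfl

@[simp] lemma neg_moment (L : DirectedLine) : (-L).moment = -L.moment := rfl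

@[simp] lemma neg_neg_line (L : DirectedLine) : - -L = L := by
  ext <;> simp

/-- The mirror image of a directed line in the line carrying edge number `i`. -/
noncomputable def bounce (V : Fin 4 → ℂ) (i : Fin 4) (L : DirectedLine) : DirectedLine where
  dir := mirror (edgeVec V i) L.dir
  -- Both lines pass through the same point of the edge line. The sum of their moments can be
  -- evaluated at any point of that line, for instance at `V i`, since the determinant with the edge
  -- vector changes sign under `mirror`.
  moment := cross (V i) L.dir + cross (V i) (mirror (edgeVec V i) L.dir) - L.moment

/-- The directed line crosses the open edge number `i`, with the first endpoint on its left. -/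
def Leaves (V : Fin 4 → ℂ) (i : Fin 4) (L : DirectedLine) : Prop :=
  cross (V i) L.dir < L.moment ∧ L.moment < cross (V (i + 1)) L.dir

lemma bounce_neg (V : Fin 4 → ℂ) (i : Fin 4) (L : DirectedLine) :
    bounce V i (-L) = -bounce V i L := by
  ext1
  · simp [bounce, mirror_neg]
  · simp only [bounce, neg_dir, neg_moment, mirror_neg, cross_neg_right]; ring

lemma bounce_bounce {V : Fin 4 → ℂ} {i : Fin 4} (h : edgeVec V i ≠ 0) (L : DirectedLine) :
    bounce V i (bounce V i L) = L := by
  ext1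
  · simp [bounce, mirror_mirror h]
  · simp only [bounce, mirror_mirror h]; ring

lemma cross_next (V : Fin 4 → ℂ) (i : Fin 4) (d : ℂ) :
    cross (V (i + 1)) d = cross (V i) d + cross (edgeVec V i) d := by
  rw [edgeVec, cross_sub_left]; ring

lemma leaves_bounce_iff {V : Fin 4 → ℂ} {i : Fin 4} (h : edgeVec V i ≠ 0) (L : DirectedLine) :
    Leaves V i (bounce V i L) ↔ Leaves V i (-L) := by
  have h1 := cross_mirror h L.dir
  simp only [Leaves, cross_next, bounce, neg_dir, neg_moment, cross_neg_right, h1]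
  constructor <;> rintro ⟨h2, h3⟩ <;> constructor <;> linarith

/-- The point where a directed line crosses edge number `i`. -/
noncomputable def hit (V : Fin 4 → ℂ) (i : Fin 4) (L : DirectedLine) : ℂ :=
  V i + ((L.moment - cross (V i) L.dir) / cross (edgeVec V i) L.dir) • edgeVec V i

lemma Leaves.cross_pos {V : Fin 4 → ℂ} {i : Fin 4} {L : DirectedLine} (h : Leaves V i L) :
    0 < cross (edgeVec V i) L.dir := by
  have := h.1.trans h.2
  rw [cross_next] at this
  linarith

lemma Leaves.edgeVec_ne_zero {V : Fin 4 → ℂ} {i : Fin 4} {L : DirectedLine}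
    (h : Leaves V i L) : edgeVec V i ≠ 0 := by
  intro h0
  have := h.cross_pos
  simp [h0, cross] at this

lemma Leaves.hit_mem {V : Fin 4 → ℂ} {i : Fin 4} {L : DirectedLine} (h : Leaves V i L) :
    hit V i L ∈ openSegment ℝ (V i) (V (i + 1)) := by
  have hc := h.cross_pos
  rw [openSegment_eq_image']
  refine ⟨_, ⟨div_pos (sub_pos.2 h.1) hc, (div_lt_one hc).2 ?_⟩, rfl⟩
  have := h.2
  rw [cross_next] at this
  linarith

lemma Leaves.cross_hit {V : Fin 4 → ℂ} {i : Fin 4} {L : DirectedLine} (h : Leaves V i L) :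
    cross (hit V i L) L.dir = L.moment := by
  have hc := h.cross_pos
  rw [hit, cross_add_left, cross_smul_left, div_mul_cancel₀ _ hc.ne']
  ring

/-- The point found from the outgoing line lies on the incoming line as well. This puts two
successive bounce points on a common line. -/
lemma cross_hit_bounce {V : Fin 4 → ℂ} {i : Fin 4} {L : DirectedLine}
    (h : Leaves V i (bounce V i L)) : cross (hit V i (bounce V i L)) L.dir = L.moment := by
  have h1 := h.cross_hit
  have h2 := cross_mirror h.edgeVec_ne_zero L.dir
  have h3 : (bounce V i L).dir = mirror (edgeVec V i) L.dir := rfl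
  have h4 : (bounce V i L).moment =
    cross (V i) L.dir + cross (V i) (mirror (edgeVec V i) L.dir) - L.moment := rfl
  rw [hit, cross_add_left, cross_smul_left, h3] at h1 ⊢
  rw [h2] at h1
  rw [h4] at h1
  rw [h2, h4] at *
  linarith

end DirectedLine

/-! ### Closed chains of lines give closed paths in convex quadrilaterals -/

/-- The quadrilateral is strictly convex and positively oriented. -/
def IsPositivelyConvex (V : Fin 4 → ℂ) : Prop :=
  ∀ i, 0 < cross (edgeVec V i) (edgeVec V (i + 1))

/-- The turning conditions at both ends of edge `i` put the other two vertices strictly on its inner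
side, and an edge `j ≠ i` has at least one of them as an endpoint. The factor `σ` allows for either
orientation. -/
lemma cross_edge_pos {V : Fin 4 → ℂ} {σ : ℝ}
    (hV : ∀ i, 0 < σ * cross (edgeVec V i) (edgeVec V (i + 1))) {i j : Fin 4} (hij : i ≠ j) {q : ℂ}
    (hq : q ∈ openSegment ℝ (V j) (V (j + 1))) : 0 < σ * cross (edgeVec V i) (q - V i) := by
  obtain ⟨a, b, ha, hb, hab, rfl⟩ := hq
  have key : ∀ k : Fin 4, k = i ∨ k = i + 1 ∨ 0 < σ * cross (edgeVec V i) (V k - V i) := by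
    intro k
    have h2 : 0 < σ * cross (edgeVec V i) (V (i + 2) - V i) := by
      have := hV i
      have e : V (i + 2) - V i = edgeVec V i + edgeVec V (i + 1) := by
        rw [edgeVec, edgeVec, add_assoc]
        simp
      rwa [e, cross_add_right, cross_self, zero_add]
    have h3 : 0 < σ * cross (edgeVec V i) (V (i + 3) - V i) := by
      have := hV (i + 3)
      have e1 : i + 3 + 1 = i := (by decide : ∀ i : Fin 4, i + 3 + 1 = i) i
      rw [e1] at this
      have e : V (i + 3) - V i = -edgeVec V (i + 3) := by
        rw [edgeVec, e1]; ring
      rwa [e, cross_neg_right, ← cross_swap]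
    have hk : k = i ∨ k = i + 1 ∨ k = i + 2 ∨ k = i + 3 :=
      (by decide : ∀ k i : Fin 4, k = i ∨ k = i + 1 ∨ k = i + 2 ∨ k = i + 3) k i
    rcases hk with rfl | rfl | rfl | rfl
    · exact Or.inl rfl
    · exact Or.inr (Or.inl rfl)
    · exact Or.inr (Or.inr h2)
    · exact Or.inr (Or.inr h3)
  have e0 : cross (edgeVec V i) (V i - V i) = 0 := by simp [cross]
  have e1 : cross (edgeVec V i) (V (i + 1) - V i) = 0 := cross_self _
  have hsplit : a • V j + b • V (j + 1) - V i = a • (V j - V i) + b • (V (j + 1) - V i) := by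
    have : V i = (a + b) • V i := by rw [hab, one_smul]
    conv_lhs => rw [this]
    simp only [smul_sub, add_smul]
    ring
  have hdis : ∀ i j : Fin 4, i ≠ j → ((j = i + 1 → (j + 1 ≠ i ∧ j + 1 ≠ i + 1)) ∧
    ((j + 1 = i ∨ j + 1 = i + 1) → (j ≠ i ∧ j ≠ i + 1))) := by decide
  have hd := hdis i j hij
  rw [hsplit, cross_add_right, cross_smul_right, cross_smul_right, mul_add, mul_left_comm,
    mul_left_comm σ b]
  rcases key j with h | h | h
  · exact absurd h.symm hij
  · have h' := hd.1 h
    rcases key (j + 1) with g | g | g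
    · exact absurd g h'.1
    · exact absurd g h'.2
    · rw [h, e1, ← h, mul_zero, mul_zero, zero_add]; positivity
  · rcases key (j + 1) with g | g | g
    · rw [g, e0, mul_zero, mul_zero, add_zero]; positivity
    · rw [g, e1, mul_zero, mul_zero, add_zero]; positivity
    · positivity

/-- A closed polygonal path that bounces, according to the law of reflection, off the lines carrying
the edges of `V` at points of the open edges named by the letters of `W`. -/
def BouncesAlong (V : Fin 4 → ℂ) (W : List (Fin 4)) : Prop :=
  W ≠ [] ∧ Even W.length ∧ ∃ (s : ℕ → Fin 4) (p : ℕ → ℂ),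
    (∀ k, p k ∈ openSegment ℝ (V (s k)) (V (s k + 1))) ∧
    (∀ k, s k ≠ s (k + 1)) ∧
    (∀ k, SameRay ℝ (mirror (edgeVec V (s (k + 1))) (p (k + 1) - p k)) (p (k + 2) - p (k + 1))) ∧
    (∀ k, p (k + W.length) = p k) ∧ ∀ k, W[k % W.length]? = some (s k)

open DirectedLine

/-- Starting with the line `x`, successive bounces off the edges named by a word lead to `y`. -/
inductive Follows (V : Fin 4 → ℂ) : DirectedLine → List (Fin 4) → DirectedLine → Prop
  | nil (x : DirectedLine) : Follows V x [] x
  | cons {x y : DirectedLine} {i : Fin 4} {W : List (Fin 4)} (h : Leaves V i (bounce V i x))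
      (hW : Follows V (bounce V i x) W y) : Follows V x (i :: W) y

namespace Follows

variable {V : Fin 4 → ℂ} {x y z : DirectedLine} {W W' : List (Fin 4)} {i : Fin 4}

lemma append (h : Follows V x W y) (h' : Follows V y W' z) : Follows V x (W ++ W') z := by
  induction h with
  | nil x => exact h'
  | cons h _ ih => exact cons h (ih h')

lemma step (h : bounce V i x = y) (hy : Leaves V i y) (hW : Follows V y W z) :
    Follows V x (i :: W) z := by
  subst h; exact cons hy hW

/-- Time reversal: bounces are involutions that commute with reversing a line. -/
lemma reverse (h : Follows V x W y) : Follows V (-y) W.reverse (-x) := by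
  induction h with
  | nil x => exact nil _
  | @cons x y i W h _ ih =>
    have he := h.edgeVec_ne_zero
    rw [List.reverse_cons]
    refine ih.append (step ?_ ((leaves_bounce_iff he x).1 h) (nil _))
    rw [bounce_neg, bounce_bounce he]

/-- A trajectory that starts at a right angle to edge `i` and ends at a right angle to edge `j`
closes up when it is run to and fro. -/
lemma closed_of_perpendicular {j : Fin 4} (hx : bounce V i (-x) = x) (hx' : Leaves V i x)
    (h : Follows V x W y) (hy : bounce V j y = -y) (hy' : Leaves V j (-y)) :
    Follows V x (W ++ j :: (W.reverse ++ [i])) x :=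
  h.append (step hy hy' (h.reverse.append (step hx hx' (nil x))))

end Follows

/-- The lines traversed when a line is successively mirrored in the edges `s 0, s 1, …`. -/
noncomputable def trajectory (V : Fin 4 → ℂ) (s : ℕ → Fin 4) (x : DirectedLine) : ℕ → DirectedLine
  | 0 => x
  | k + 1 => bounce V (s k) (trajectory V s x k)

lemma trajectory_succ' (V : Fin 4 → ℂ) (s : ℕ → Fin 4) (x : DirectedLine) (k : ℕ) :
    trajectory V s x (k + 1) = trajectory V (fun l => s (l + 1)) (bounce V (s 0) x) k := by
  induction k with
  | zero => rfl
  | succ k ih => rw [trajectory, ih]; rfl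

lemma Follows.leaves_trajectory {V : Fin 4 → ℂ} {x y : DirectedLine} {W : List (Fin 4)}
    (h : Follows V x W y) : ∀ s : ℕ → Fin 4, (∀ k < W.length, W[k]? = some (s k)) →
      (∀ k < W.length, Leaves V (s k) (trajectory V s x (k + 1))) ∧
        trajectory V s x W.length = y := by
  induction h with
  | nil x => intro s _; simp [trajectory]
  | @cons x y i W h _ ih =>
    intro s hs
    have h0 : s 0 = i := by simpa using (hs 0 (by simp)).symm
    obtain ⟨h1, h2⟩ := ih (fun l => s (l + 1)) (fun k hk => by
      simpa using hs (k + 1) (by simpa using hk))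
    constructor
    · intro k hk
      cases k with
      | zero => simpa [trajectory, h0] using h
      | succ k =>
        rw [trajectory_succ', h0]
        exact h1 k (by simpa using hk)
    · rw [List.length_cons, trajectory_succ', h0, h2]

/-- The bounce points are the crossings of the successive lines with the edges. What has to be shown
is that the ball moves forwards: the line points inwards at the edge it leaves, and by convexity the
next bounce point lies on the inner side of that edge. -/
lemma Follows.bouncesAlong {V : Fin 4 → ℂ} {x : DirectedLine} {W : List (Fin 4)}
    (hV : IsPositivelyConvex V) (h : Follows V x W x) (hW : W ≠ []) (he : Even W.length) :
    BouncesAlong V W := by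
  have hn : 0 < W.length := List.length_pos_of_ne_nil hW
  set n := W.length with hn_def
  set s : ℕ → Fin 4 := fun k => W[k % n]'(Nat.mod_lt _ hn) with hs
  have hWs : ∀ k, W[k % n]? = some (s k) := fun k => List.getElem?_eq_getElem _
  have hper : ∀ k, s (k + n) = s k := fun k => by simp [hs]
  obtain ⟨h1, h2⟩ := h.leaves_trajectory s (fun k hk => by
    rw [← hWs k, Nat.mod_eq_of_lt hk])
  set L := trajectory V s x with hL
  have hLper : ∀ k, L (k + n) = L k := by
    intro k
    induction k with
    | zero => rw [zero_add, h2]; rfl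
    | succ k ih =>
      have e1 : L (k + 1) = bounce V (s k) (L k) := rfl
      have e2 : L (k + n + 1) = bounce V (s (k + n)) (L (k + n)) := rfl
      rw [add_right_comm, e2, e1, ih, hper]
  have hleaves : ∀ k, Leaves V (s k) (L (k + 1)) := by
    have hp : Function.Periodic (fun k => (s k, L (k + 1))) n := by
      intro k
      simp only [hper, add_right_comm k n 1, hLper]
    intro k
    have e := hp.map_mod_nat k
    simp only [Prod.mk.injEq] at e
    rw [← e.1, ← e.2]
    exact h1 _ (Nat.mod_lt _ hn)
  have hstep : ∀ k, L (k + 2) = bounce V (s (k + 1)) (L (k + 1)) := fun k => rfl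
  -- A line that leaves an edge points inwards there; a second bounce off the same edge would make
  -- it point outwards.
  have hne : ∀ k, s k ≠ s (k + 1) := by
    intro k hk
    have c1 := (hleaves k).cross_pos
    have c2 := (hleaves (k + 1)).cross_pos
    rw [hstep k, bounce, cross_mirror (hleaves (k + 1)).edgeVec_ne_zero, ← hk] at c2
    linarith
  have hmem : ∀ k, hit V (s k) (L (k + 1)) ∈ openSegment ℝ (V (s k)) (V (s k + 1)) :=
    fun k => (hleaves k).hit_mem
  have hray : ∀ k, ∃ r : ℝ, 0 < r ∧
      hit V (s (k + 1)) (L (k + 2)) - hit V (s k) (L (k + 1)) = r • (L (k + 1)).dir := by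
    intro k
    have c1 := (hleaves k).cross_pos
    have c2 := (hleaves k).cross_hit
    have c3 : cross (hit V (s (k + 1)) (L (k + 2))) (L (k + 1)).dir = (L (k + 1)).moment := by
      rw [hstep k]
      refine cross_hit_bounce ?_
      rw [← hstep k]
      exact hleaves (k + 1)
    have c4 := cross_edge_pos (σ := 1) (fun i => by simpa using hV i) (hne k) (hmem (k + 1))
    set q := hit V (s (k + 1)) (L (k + 2))
    set p := hit V (s k) (L (k + 1)) with hp
    have c5 : cross (edgeVec V (s k)) (q - p) = cross (edgeVec V (s k)) (q - V (s k)) := by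
      rw [hp, hit, ← sub_sub, cross_sub_right, cross_smul_right, cross_self, mul_zero, sub_zero]
    have c6 := cross_smul_sub_smul (edgeVec V (s k)) (L (k + 1)).dir (q - p)
    rw [cross_sub_left, c3, c2, sub_self, zero_smul, c5, sub_eq_zero] at c6
    rw [one_mul] at c4
    refine ⟨_, div_pos c4 c1, ?_⟩
    rw [div_eq_inv_mul, mul_smul, ← c6, inv_smul_smul₀ c1.ne']
  refine ⟨hW, he, s, fun k => hit V (s k) (L (k + 1)), hmem, hne, ?_, ?_, hWs⟩
  · intro k
    obtain ⟨r, hr, e1⟩ := hray k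
    obtain ⟨r', hr', e2⟩ := hray (k + 1)
    have e3 : (L (k + 1 + 1)).dir = mirror (edgeVec V (s (k + 1))) (L (k + 1)).dir := rfl
    simp only [e1]
    rw [show k + 2 = k + 1 + 1 from rfl, e2, mirror_smul, e3]
    exact ((SameRay.refl _).pos_smul_left hr).pos_smul_right hr'
  · intro k
    change hit V (s (k + n)) (L (k + n + 1)) = _
    rw [hper, add_right_comm, hLper]

/-! ### Paths in a strictly convex quadrilateral stay inside the table -/

lemma mem_convexHull_of_cross {x y z q : ℂ} {σ : ℝ} (h : 0 < σ * cross (y - x) (z - y))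
    (h1 : 0 ≤ σ * cross (y - x) (q - x)) (h2 : 0 ≤ σ * cross (z - y) (q - y))
    (h3 : 0 ≤ σ * cross (x - z) (q - z)) : q ∈ convexHull ℝ {x, y, z} := by
  have hsum : σ * cross (z - y) (q - y) + σ * cross (x - z) (q - z) + σ * cross (y - x) (q - x) =
      σ * cross (y - x) (z - y) := by
    simp only [cross, Complex.sub_re, Complex.sub_im]; ring
  set D := σ * cross (y - x) (z - y) with hD
  have hd : D ≠ 0 := h.ne'
  have hq : (σ * cross (z - y) (q - y) / D) • x + (σ * cross (x - z) (q - z) / D) • y +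
      (σ * cross (y - x) (q - x) / D) • z = q := by
    apply Complex.ext <;>
      simp only [Complex.add_re, Complex.add_im, Complex.smul_re, Complex.smul_im,
        smul_eq_mul] <;> field_simp <;> rw [hD] <;>
      simp only [cross, Complex.sub_re, Complex.sub_im] <;> ring
  have := (convex_convexHull ℝ {x, y, z}).sum_mem (t := Finset.univ)
    (w := ![σ * cross (z - y) (q - y) / D, σ * cross (x - z) (q - z) / D,
      σ * cross (y - x) (q - x) / D]) (z := ![x, y, z])
    (by
      intro i _
      fin_cases i
      · exact div_nonneg h2 h.le
      · exact div_nonneg h3 h.le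
      · exact div_nonneg h1 h.le)
    (by
      simp only [Fin.sum_univ_three, Matrix.cons_val]
      rw [← add_div, ← add_div, hsum, div_self hd])
    (by
      intro i _
      apply subset_convexHull
      fin_cases i <;> simp)
  simpa only [Fin.sum_univ_three, Matrix.cons_val, hq] using this

/-- By Cramer's rule `y` differs from a suitable point of the line by a multiple of `x - p`; the
factor is the quotient of the two determinants and hence negative. -/
lemma sOppSide_of_cross {p q x y : ℂ}
    (h : cross (q - p) (x - p) * cross (q - p) (y - p) < 0) : line[ℝ, p, q].SOppSide x y := by
  have hline : ∀ z ∈ line[ℝ, p, q], cross (q - p) (z - p) = 0 := by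
    intro z hz
    obtain ⟨r, rfl⟩ := mem_affineSpan_pair_iff_exists_lineMap_eq.1 hz
    rw [AffineMap.lineMap_apply, vsub_eq_sub, vadd_eq_add, add_sub_cancel_right, cross_smul_right,
      cross_self, mul_zero]
  have hx : cross (q - p) (x - p) ≠ 0 := by rintro h0; simp [h0] at h
  have hy : cross (q - p) (y - p) ≠ 0 := by rintro h0; simp [h0] at h
  have key := cross_smul_sub_smul (q - p) (x - p) (y - p)
  set c := cross (q - p) (x - p)
  set d := cross (q - p) (y - p)
  refine AffineSubspace.sOppSide_of_vsub_eq_smul (p₁ := p)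
    (p₂ := AffineMap.lineMap p q (cross (y - p) (x - p) / c)) (m := x - p) (c₁ := 1) (c₂ := d / c)
    (left_mem_affineSpan_pair ℝ p q) (AffineMap.lineMap_mem_affineSpan_pair _ p q)
    (by simp) ?_ ?_ (fun h' => hx (hline x h')) (fun h' => hy (hline y h'))
  · rw [AffineMap.lineMap_apply, vsub_eq_sub, vsub_eq_sub, vadd_eq_add, div_eq_inv_mul,
      div_eq_inv_mul, mul_smul, mul_smul, ← key, smul_sub, inv_smul_smul₀ hx]
    ring
  · rw [one_mul]
    have h2 : 0 < c * c := mul_self_pos.2 hx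
    have : d / c = c * d / (c * c) := by field_simp
    rw [this]
    exact (div_neg_of_neg_of_pos h h2).le

/-- The quadrilateral is strictly convex, with either orientation. -/
def IsStrictlyConvex (V : Fin 4 → ℂ) : Prop :=
  ∃ σ : ℝ, ∀ i, 0 < σ * cross (edgeVec V i) (edgeVec V (i + 1))

lemma IsPositivelyConvex.isStrictlyConvex {V : Fin 4 → ℂ} (h : IsPositivelyConvex V) :
    IsStrictlyConvex V :=
  ⟨1, fun i => by simpa using h i⟩

/-- The diagonal from vertex 0 to vertex 2 separates the other two by convexity, and the side of it
on which `x` lies decides which of the two triangles contains `x`. -/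
lemma mem_table_of_cross (P : Quadrilateral) {σ : ℝ}
    (hV : ∀ i, 0 < σ * cross (edgeVec P.1 i) (edgeVec P.1 (i + 1))) {x : ℂ}
    (hx : ∀ i, 0 < σ * cross (edgeVec P.1 i) (x - P.1 i)) : x ∈ P.table := by
  have c0 : 0 < σ * cross (P.1 1 - P.1 0) (P.1 2 - P.1 1) := hV 0
  have c2 : 0 < σ * cross (P.1 3 - P.1 2) (P.1 0 - P.1 3) := hV 2
  have x0 : 0 < σ * cross (P.1 1 - P.1 0) (x - P.1 0) := hx 0
  have x1 : 0 < σ * cross (P.1 2 - P.1 1) (x - P.1 1) := hx 1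
  have x2 : 0 < σ * cross (P.1 3 - P.1 2) (x - P.1 2) := hx 2
  have x3 : 0 < σ * cross (P.1 0 - P.1 3) (x - P.1 3) := hx 3
  refine Or.inl ⟨sOppSide_of_cross ?_, ?_⟩
  · have e1 : σ * cross (P.1 2 - P.1 0) (P.1 1 - P.1 0) =
        -(σ * cross (P.1 1 - P.1 0) (P.1 2 - P.1 1)) := by
      simp only [cross, Complex.sub_re, Complex.sub_im]; ring
    have e2 : σ * cross (P.1 2 - P.1 0) (P.1 3 - P.1 0) =
        σ * cross (P.1 3 - P.1 2) (P.1 0 - P.1 3) := by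
      simp only [cross, Complex.sub_re, Complex.sub_im]; ring
    by_contra! hc
    have h3 : 0 < (σ * cross (P.1 1 - P.1 0) (P.1 2 - P.1 1)) *
      (σ * cross (P.1 3 - P.1 2) (P.1 0 - P.1 3)) := mul_pos c0 c2
    have h4 : 0 ≤ σ * σ * (cross (P.1 2 - P.1 0) (P.1 1 - P.1 0) *
      cross (P.1 2 - P.1 0) (P.1 3 - P.1 0)) := mul_nonneg (mul_self_nonneg σ) hc
    rw [mul_mul_mul_comm, e1, e2] at h4
    linarith
  · have e3 : σ * cross (P.1 2 - P.1 0) (x - P.1 0) = -(σ * cross (P.1 0 - P.1 2) (x - P.1 2)) := by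
      simp only [cross, Complex.sub_re, Complex.sub_im]; ring
    rcases le_total 0 (σ * cross (P.1 2 - P.1 0) (x - P.1 0)) with h | h
    · exact Or.inr (mem_convexHull_of_cross c2 x2.le x3.le h)
    · exact Or.inl (mem_convexHull_of_cross c0 x0.le x1.le (by linarith))

lemma continuous_cross_right (e v : ℂ) : Continuous fun x => cross e (x - v) := by
  unfold cross; fun_prop

/-- In a strictly convex quadrilateral a path from edge to edge automatically stays inside. -/
lemma BouncesAlong.hasOrbitType {P : Quadrilateral} {W : List (Fin 4)} (hP : IsStrictlyConvex P.1)
    (h : BouncesAlong P.1 W) : P.HasOrbitType W := by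
  obtain ⟨σ, hV⟩ := hP
  obtain ⟨h0, h1, s, p, hmem, hne, hrefl, hper, hW⟩ := h
  refine ⟨h0, h1, s, p, ⟨hmem, ?_, ?_⟩, hper, hW⟩
  · intro k
    have hopen : IsOpen {x | ∀ i, 0 < σ * cross (edgeVec P.1 i) (x - P.1 i)} := by
      rw [Set.ofPred_forall]
      exact isOpen_iInter_of_finite fun i =>
        isOpen_lt continuous_const (continuous_const.mul (continuous_cross_right _ _))
    refine subset_trans ?_ (interior_maximal (fun x hx => mem_table_of_cross P hV hx) hopen)
    rintro _ ⟨a, b, ha, hb, hab, rfl⟩ i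
    have e : a • p k + b • p (k + 1) - P.1 i = a • (p k - P.1 i) + b • (p (k + 1) - P.1 i) := by
      have : P.1 i = (a + b) • P.1 i := by rw [hab, one_smul]
      conv_lhs => rw [this]
      simp only [smul_sub, add_smul]
      ring
    have hz : ∀ l, s l = i → cross (edgeVec P.1 i) (p l - P.1 i) = 0 := by
      intro l hl
      have := hmem l
      rw [hl, openSegment_eq_image'] at this
      obtain ⟨r, -, hr⟩ := this
      rw [← hr, add_sub_cancel_left, cross_smul_right, edgeVec, cross_self, mul_zero]
    rw [e, cross_add_right, cross_smul_right, cross_smul_right, mul_add, mul_left_comm,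
      mul_left_comm σ b]
    -- Both ends of the segment lie on the inner side of edge `i` or on it, and not both lie on it
    -- because successive edges differ.
    by_cases hk : i = s k
    · have h2 := cross_edge_pos hV (hk ▸ hne k) (hmem (k + 1))
      rw [hz k hk.symm, mul_zero, mul_zero, zero_add]
      positivity
    · have h2 := cross_edge_pos hV hk (hmem k)
      by_cases hk' : i = s (k + 1)
      · rw [hz (k + 1) hk'.symm, mul_zero, mul_zero, add_zero]
        positivity
      · have h3 := cross_edge_pos hV hk' (hmem (k + 1))
        positivity
  · intro k
    have he : edgeVec P.1 (s (k + 1)) ≠ 0 := by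
      intro h0
      have := hV (s (k + 1))
      simp [h0, cross] at this
    have := hrefl k
    rwa [← reflection_eq_mirror he] at this

/-! ### Invariance under similarities and relabellings -/

lemma BouncesAlong.map {V : Fin 4 → ℂ} {W : List (Fin 4)} (h : BouncesAlong V W) (g : ℂ →ₗ[ℝ] ℂ)
    (hg : ∀ e d, mirror (g e) (g d) = g (mirror e d)) (t : ℂ) :
    BouncesAlong (fun i => g (V i) + t) W := by
  obtain ⟨h0, h1, s, p, hmem, hne, hrefl, hper, hW⟩ := h
  refine ⟨h0, h1, s, fun k => g (p k) + t, ?_, hne, ?_, fun k => by simp only [hper], hW⟩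
  · intro k
    obtain ⟨a, b, ha, hb, hab, e⟩ := hmem k
    refine ⟨a, b, ha, hb, hab, ?_⟩
    have : t = (a + b) • t := by rw [hab, one_smul]
    beta_reduce
    rw [← e, map_add, map_smul, map_smul]
    conv_rhs => rw [this]
    simp only [smul_add, add_smul]
    ring
  · intro k
    have := (hrefl k).map g
    simpa only [edgeVec, add_sub_add_right_eq_sub, ← map_sub, hg] using this

/-- Two labelled quadrilaterals correspond under a similarity of the plane. -/
def SimilarityRelated (V V' : Fin 4 → ℂ) : Prop :=
  ∃ c t : ℂ, c ≠ 0 ∧ ((∀ i, V' i = c * V i + t) ∨ ∀ i, V' i = c * conj (V i) + t)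

lemma BouncesAlong.of_similarityRelated {V V' : Fin 4 → ℂ} {W : List (Fin 4)}
    (h : SimilarityRelated V V') (hV : BouncesAlong V W) : BouncesAlong V' W := by
  obtain ⟨c, t, hc, h | h⟩ := h
  · rw [funext h]
    refine hV.map (LinearMap.mulLeft ℝ c) (fun e d => ?_) t
    have hc' : conj c ≠ 0 := (map_ne_zero _).2 hc
    rcases eq_or_ne e 0 with rfl | he
    · simp [mirror]
    have he' : conj e ≠ 0 := (map_ne_zero _).2 he
    simp only [LinearMap.mulLeft_apply, mirror, map_mul]
    field_simp
  · rw [funext h]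
    refine hV.map (LinearMap.mulLeft ℝ c ∘ₗ Complex.conjAe.toLinearMap) (fun e d => ?_) t
    have hc' : conj c ≠ 0 := (map_ne_zero _).2 hc
    rcases eq_or_ne e 0 with rfl | he
    · simp [mirror]
    have he' : conj e ≠ 0 := (map_ne_zero _).2 he
    simp only [LinearMap.comp_apply, LinearMap.mulLeft_apply, AlgEquiv.toLinearMap_apply,
      Complex.conjAe_coe, mirror, map_mul, map_div₀, Complex.conj_conj]
    field_simp

lemma IsStrictlyConvex.of_similarityRelated {V V' : Fin 4 → ℂ} (h : SimilarityRelated V V')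
    (hV : IsStrictlyConvex V) : IsStrictlyConvex V' := by
  obtain ⟨c, t, hc, h | h⟩ := h <;> obtain ⟨σ, hV⟩ := hV
  · refine ⟨σ, fun i => ?_⟩
    have : ∀ i, edgeVec V' i = c * edgeVec V i := fun i => by simp only [edgeVec, h]; ring
    rw [this, this, cross_mul_mul, mul_left_comm]
    exact mul_pos (Complex.normSq_pos.2 hc) (hV i)
  · refine ⟨-σ, fun i => ?_⟩
    have : ∀ i, edgeVec V' i = c * conj (edgeVec V i) := fun i => by
      simp only [edgeVec, h, map_sub]; ring
    rw [this, this, cross_mul_mul, mul_left_comm, cross_conj_conj, neg_mul_neg]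
    exact mul_pos (Complex.normSq_pos.2 hc) (hV i)

lemma BouncesAlong.rotate {V : Fin 4 → ℂ} {W : List (Fin 4)} (a : Fin 4)
    (h : BouncesAlong (fun j => V (a + j)) W) : BouncesAlong V (W.map fun i => a + i) := by
  obtain ⟨h0, h1, s, p, hmem, hne, hrefl, hper, hW⟩ := h
  refine ⟨by simpa using h0, by simpa using h1, fun k => a + s k, p, ?_,
    fun k e => hne k (add_left_cancel e), ?_, by simpa using hper, fun k => ?_⟩
  · simpa only [add_assoc] using hmem
  · simpa only [edgeVec, add_assoc] using hrefl
  · rw [List.length_map, List.getElem?_map, hW, Option.map_some]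

/-- Vertices are relabelled by `a + 1 - j` so that edges are relabelled by `a - i`: new edge `i`
joins old vertices `a + 1 - i` and `a - i`, which is old edge `a - i` run backwards. -/
lemma BouncesAlong.reflect {V : Fin 4 → ℂ} {W : List (Fin 4)} (a : Fin 4)
    (h : BouncesAlong (fun j => V (a + 1 - j)) W) : BouncesAlong V (W.map fun i => a - i) := by
  obtain ⟨h0, h1, s, p, hmem, hne, hrefl, hper, hW⟩ := h
  have e1 : ∀ a i : Fin 4, a + 1 - i = a - i + 1 := by decide
  have e2 : ∀ a i : Fin 4, a + 1 - (i + 1) = a - i := by decide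
  refine ⟨by simpa using h0, by simpa using h1, fun k => a - s k, p, ?_,
    fun k e => hne k (sub_right_injective e), ?_, by simpa using hper, fun k => ?_⟩
  · intro k
    have := hmem k
    beta_reduce at this
    rwa [e2, e1, openSegment_symm] at this
  · intro k
    have := hrefl k
    have e3 : edgeVec (fun j => V (a + 1 - j)) (s (k + 1)) = -edgeVec V (a - s (k + 1)) := by
      simp only [edgeVec, e2, neg_sub]
      rw [e1]
    rw [e3] at this
    simpa only [mirror, map_neg, neg_div_neg_eq] using this
  · rw [List.length_map, List.getElem?_map, hW, Option.map_some]

/-- Some relabelling of one of the basic words describes a closed path. -/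
def HasBasicPath (V : Fin 4 → ℂ) : Prop :=
  ∃ U ∈ basicOrbitTypes, ∃ W, IsRelabelling W U ∧ BouncesAlong V W

lemma HasBasicPath.rotate {V : Fin 4 → ℂ} (a : Fin 4)
    (h : HasBasicPath (fun j => V (a + j))) : HasBasicPath V := by
  obtain ⟨U, hU, _, ⟨b, rfl | rfl⟩, h⟩ := h
  · exact ⟨U, hU, _, ⟨a + b, Or.inl (by simp [add_assoc])⟩, h.rotate a⟩
  · exact ⟨U, hU, _, ⟨a + b, Or.inr (by simp [add_sub_assoc])⟩, h.rotate a⟩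

lemma HasBasicPath.reflect {V : Fin 4 → ℂ} (a : Fin 4)
    (h : HasBasicPath (fun j => V (a + 1 - j))) : HasBasicPath V := by
  obtain ⟨U, hU, _, ⟨b, rfl | rfl⟩, h⟩ := h
  · refine ⟨U, hU, _, ⟨a - b, Or.inr ?_⟩, h.reflect a⟩
    rw [List.map_map]
    congr 1
    funext i
    exact (by decide : ∀ a b i : Fin 4, a - (b + i) = a - b - i) a b i
  · refine ⟨U, hU, _, ⟨a - b, Or.inl ?_⟩, h.reflect a⟩
    rw [List.map_map]
    congr 1
    funext i
    exact (by decide : ∀ a b i : Fin 4, a - (b - i) = a - b + i) a b i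

lemma HasBasicPath.of_similarityRelated {V V' : Fin 4 → ℂ}
    (h : SimilarityRelated V V') (hV : HasBasicPath V) : HasBasicPath V' := by
  obtain ⟨U, hU, W, hW, hV⟩ := hV
  exact ⟨U, hU, W, hW, hV.of_similarityRelated h⟩

/-! ### Nearly horizontal lines close to edge 0 -/

/-- The quadrilateral with vertices `0, 1, a, b`. -/
def quad (a b : ℂ) : Fin 4 → ℂ := ![0, 1, a, b]

lemma edgeVec_quad_zero (a b : ℂ) : edgeVec (quad a b) 0 = 1 := by simp [edgeVec, quad]
lemma edgeVec_quad_one (a b : ℂ) : edgeVec (quad a b) 1 = a - 1 := by simp [edgeVec, quad]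
lemma edgeVec_quad_two (a b : ℂ) : edgeVec (quad a b) 2 = b - a := by simp [edgeVec, quad]
lemma edgeVec_quad_three (a b : ℂ) : edgeVec (quad a b) 3 = -b := by simp [edgeVec, quad]

/-- The line pointing to the right at slope angle `ψ`. -/
noncomputable def rightward (ψ m : ℝ) : DirectedLine := ⟨Complex.exp (ψ * Complex.I), m⟩

/-- The line pointing to the left at slope angle `ψ`. -/
noncomputable def leftward (ψ m : ℝ) : DirectedLine := ⟨-Complex.exp (ψ * Complex.I), m⟩

lemma neg_rightward (ψ m : ℝ) : -rightward ψ m = leftward ψ (-m) := rfl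

lemma neg_leftward (ψ m : ℝ) : -leftward ψ m = rightward ψ (-m) := by
  rw [← neg_neg_line (rightward ψ (-m)), neg_rightward, neg_neg]

lemma conj_exp (ψ : ℝ) : conj (Complex.exp (ψ * Complex.I)) = Complex.exp (-ψ * Complex.I) := by
  rw [← Complex.exp_conj]
  simp

lemma cross_one_left (d : ℂ) : cross 1 d = d.im := by simp [cross]

lemma cross_zero_left (d : ℂ) : cross 0 d = 0 := by simp [cross]

/-- Edges `3` and `1` of the quadrilateral `0, 1, a, b` make the angles `π / 2 - A` and
`π / 2 + B` with edge `0`, and nearly horizontal lines through points near `0` and `1` stay away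
from the vertices `a` and `b`. -/
structure IsFrame (a b : ℂ) (A B κ : ℝ) : Prop where
  mirror_three : ∀ d, mirror (edgeVec (quad a b) 3) d =
    -Complex.exp (-(2 * A) * Complex.I) * conj d
  mirror_one : ∀ d, mirror (edgeVec (quad a b) 1) d =
    -Complex.exp (-(2 * B) * Complex.I) * conj d
  right_far : ∀ ψ m : ℝ, |ψ| ≤ κ → |m| ≤ κ → m < cross a (-Complex.exp (ψ * Complex.I))
  left_far : ∀ ψ m : ℝ, |ψ| ≤ κ → |m| ≤ κ → cross b (Complex.exp (ψ * Complex.I)) < m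
  convex : IsPositivelyConvex (quad a b)

lemma bounce_zero_rightward (a b : ℂ) (ψ m : ℝ) :
    bounce (quad a b) 0 (rightward ψ m) = rightward (-ψ) (-m) := by
  have h : mirror (edgeVec (quad a b) 0) (rightward ψ m).dir = (rightward (-ψ) (-m)).dir := by
    simp only [edgeVec_quad_zero, mirror, rightward, conj_exp]; simp
  ext1
  · exact h
  · simp only [bounce, h]
    simp [quad, rightward, cross_zero_left]

lemma leaves_zero_rightward {a b : ℂ} {ψ m : ℝ} (h0 : 0 < m) (h1 : m < Real.sin ψ) :
    Leaves (quad a b) 0 (rightward ψ m) := by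
  refine ⟨?_, ?_⟩
  · simpa [quad, cross_zero_left, rightward] using h0
  · simpa [quad, cross_one_left, rightward, Complex.exp_ofReal_mul_I_im] using h1

lemma step_zero {a b : ℂ} {ψ m : ℝ} {W : List (Fin 4)} {z : DirectedLine} (h0 : m < 0)
    (h1 : -m < Real.sin (-ψ)) (hW : Follows (quad a b) (rightward (-ψ) (-m)) W z) :
    Follows (quad a b) (rightward ψ m) (0 :: W) z :=
  Follows.step (bounce_zero_rightward a b ψ m) (leaves_zero_rightward (by linarith) h1) hW

namespace IsFrame

variable {a b : ℂ} {A B κ : ℝ} (h : IsFrame a b A B κ)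
include h

lemma bounce_one (ψ m : ℝ) : bounce (quad a b) 1 (rightward ψ m) =
    leftward (-(2 * B) - ψ) (Real.sin ψ - Real.sin (-(2 * B) - ψ) - m) := by
  have h1 : mirror (edgeVec (quad a b) 1) (rightward ψ m).dir =
      -Complex.exp ((-(2 * B) - ψ : ℝ) * Complex.I) := by
    rw [h.mirror_one, rightward, conj_exp, neg_mul, ← Complex.exp_add]
    congr 2
    push_cast
    ring
  ext1
  · exact h1
  · simp only [bounce, h1]
    simp only [quad, Matrix.cons_val, cross_one_left, Complex.neg_im,
      Complex.exp_ofReal_mul_I_im, rightward, leftward]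
    ring

/-- Moments are taken about vertex 0, which lies on edge 3 as well as on edge 0, so these two
bounces merely change the sign of the moment. Only bounces off edge 1 alter its absolute value. -/
lemma bounce_three (ψ m : ℝ) :
    bounce (quad a b) 3 (leftward ψ m) = rightward (-(2 * A) - ψ) (-m) := by
  set V := quad a b with hV
  have h1 : mirror (edgeVec V 3) (leftward ψ m).dir =
      Complex.exp ((-(2 * A) - ψ : ℝ) * Complex.I) := by
    rw [h.mirror_three, leftward, map_neg, conj_exp, neg_mul_neg, ← Complex.exp_add]
    congr 1
    push_cast
    ring
  have h2 := cross_mirror (e := edgeVec V 3) (by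
    intro h0
    have := h.convex 3
    simp [← hV, h0, cross] at this) (leftward ψ m).dir
  have h3 : edgeVec V 3 = -V 3 := by simp [hV, edgeVec, quad]
  ext1
  · exact h1
  · have h4 : cross (V 3) (mirror (edgeVec V 3) (leftward ψ m).dir) =
        -cross (V 3) (leftward ψ m).dir := by
      rw [h3, cross_neg_left, cross_neg_left] at h2
      rw [h3]
      linarith
    change cross (V 3) (leftward ψ m).dir +
      cross (V 3) (mirror (edgeVec V 3) (leftward ψ m).dir) - m = -m
    rw [h4]
    ring

/-- Only the lower endpoint of the edge imposes a condition; the upper one is taken care of by the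
bound `κ`. The same holds for edge 3. -/
lemma leaves_one {ψ m : ℝ} (h1 : -Real.sin ψ < m) (hψ : |ψ| ≤ κ) (hm : |m| ≤ κ) :
    Leaves (quad a b) 1 (leftward ψ m) := by
  refine ⟨?_, ?_⟩
  · simpa [quad, cross_one_left, leftward, Complex.exp_ofReal_mul_I_im] using h1
  · exact h.right_far ψ m hψ hm

lemma leaves_three {ψ m : ℝ} (h1 : m < 0) (hψ : |ψ| ≤ κ) (hm : |m| ≤ κ) :
    Leaves (quad a b) 3 (rightward ψ m) := by
  refine ⟨?_, ?_⟩
  · exact h.left_far ψ m hψ hm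
  · simpa [quad, cross_zero_left, rightward] using h1

lemma step_one {ψ m ψ' m' : ℝ} {W : List (Fin 4)} {z : DirectedLine} (e : ψ' = -(2 * B) - ψ)
    (e' : m' = Real.sin ψ - Real.sin ψ' - m) (h1 : -Real.sin ψ' < m') (hψ : |ψ'| ≤ κ)
    (hm : |m'| ≤ κ) (hW : Follows (quad a b) (leftward ψ' m') W z) :
    Follows (quad a b) (rightward ψ m) (1 :: W) z := by
  subst e e'
  exact Follows.step (h.bounce_one ψ m) (h.leaves_one h1 hψ hm) hW

lemma step_three {ψ m ψ' m' : ℝ} {W : List (Fin 4)} {z : DirectedLine} (e : ψ' = -(2 * A) - ψ)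
    (e' : m' = -m) (h1 : m' < 0) (hψ : |ψ'| ≤ κ)
    (hm : |m'| ≤ κ) (hW : Follows (quad a b) (rightward ψ' m') W z) :
    Follows (quad a b) (leftward ψ m) (3 :: W) z := by
  subst e e'
  exact Follows.step (h.bounce_three ψ m) (h.leaves_three h1 hψ hm) hW

end IsFrame

lemma abs_sin_le_of_abs_le {x t : ℝ} (h : |x| ≤ t) : -t ≤ Real.sin x ∧ Real.sin x ≤ t :=
  abs_le.1 (Real.abs_sin_le_abs.trans h)

lemma Follows.hasBasicPath {V : Fin 4 → ℂ} {x : DirectedLine} {W U : List (Fin 4)}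
    (h : Follows V x W x) (hV : IsPositivelyConvex V) (hU : U ∈ basicOrbitTypes) (h0 : W ≠ [])
    (he : Even W.length) (a : Fin 4) (hW : W = U.map fun i => a + i) : HasBasicPath V :=
  ⟨U, hU, W, ⟨a, Or.inl hW⟩, h.bouncesAlong hV h0 he⟩

/-- These are the inequalities that leave room for the path X₃. To first order the left side of the
first is 6(3B - A), and the two sides of the second differ by 12(A - 2B). The identities `low` and
`key` turn this into exact statements. -/
lemma sin_sums_of_ratio_lt_half {A B : ℝ} (hB : A < 3 * B) (hAB : 2 * B < A) (hA' : A ≤ 1 / 10) :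
    0 < Real.sin A + Real.sin (A + 2 * B) - Real.sin (A - 2 * B) - Real.sin (A - 4 * B) -
      Real.sin (3 * A - 4 * B) - Real.sin (3 * A - 6 * B) ∧
    Real.sin (A + 2 * B) - Real.sin (A - 2 * B) - Real.sin (A - 4 * B) -
      Real.sin (3 * A - 4 * B) - Real.sin (3 * A - 6 * B) < Real.sin (5 * A - 6 * B) := by
  have hpi := Real.pi_gt_three
  have s7 : Real.sin (2 * B) < Real.sin (4 * A - 6 * B) :=
    Real.sin_lt_sin_of_lt_of_le_pi_div_two (by linarith) (by linarith) (by linarith)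
  have s8 : 0 < Real.sin (2 * A - 4 * B) :=
    Real.sin_pos_of_pos_of_lt_pi (by linarith) (by linarith)
  have s9 : 0 < Real.sin (3 * B - A) :=
    Real.sin_pos_of_pos_of_lt_pi (by linarith) (by linarith)
  have cA : 0 < Real.cos A := Real.cos_pos_of_mem_Ioo ⟨by linarith, by linarith⟩
  have cB : 0 < Real.cos B := Real.cos_pos_of_mem_Ioo ⟨by linarith, by linarith⟩
  have c1 : 0 < Real.cos (3 * B - 2 * A) :=
    Real.cos_pos_of_mem_Ioo ⟨by linarith, by linarith⟩
  have c2 : 0 < Real.cos (B - 2 * A) := Real.cos_pos_of_mem_Ioo ⟨by linarith, by linarith⟩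
  have key : Real.sin (5 * A - 6 * B) + Real.sin (3 * A - 6 * B) + Real.sin (3 * A - 4 * B) +
      Real.sin (A - 4 * B) + Real.sin (A - 2 * B) - Real.sin (A + 2 * B) =
      2 * Real.cos A * (Real.sin (4 * A - 6 * B) - Real.sin (2 * B) +
        Real.sin (2 * A - 4 * B)) := by
    rw [show 5 * A - 6 * B = (4 * A - 6 * B) + A by ring,
      show 3 * A - 6 * B = (4 * A - 6 * B) - A by ring,
      show 3 * A - 4 * B = (2 * A - 4 * B) + A by ring,
      show A - 4 * B = (2 * A - 4 * B) - A by ring]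
    simp only [Real.sin_add, Real.sin_sub A (2 * B), Real.sin_sub (2 * A - 4 * B) A,
      Real.sin_sub (4 * A - 6 * B) A]
    ring
  have key' : 0 < 2 * Real.cos A * (Real.sin (4 * A - 6 * B) - Real.sin (2 * B) +
        Real.sin (2 * A - 4 * B)) :=
    mul_pos (by linarith) (by linarith)
  have low : Real.sin A + Real.sin (A + 2 * B) - Real.sin (A - 2 * B) - Real.sin (A - 4 * B) -
      Real.sin (3 * A - 4 * B) - Real.sin (3 * A - 6 * B) =
      2 * Real.sin (3 * B - A) *
        (Real.cos (3 * B - 2 * A) + Real.cos (B - 2 * A) + Real.cos B) := by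
    rw [show Real.sin A = Real.sin ((3 * B - A) - (3 * B - 2 * A)) by ring_nf,
      show Real.sin (3 * A - 6 * B) = -Real.sin ((3 * B - A) + (3 * B - 2 * A)) by
        rw [← Real.sin_neg]; ring_nf,
      show Real.sin (A + 2 * B) = Real.sin ((3 * B - A) - (B - 2 * A)) by ring_nf,
      show Real.sin (3 * A - 4 * B) = -Real.sin ((3 * B - A) + (B - 2 * A)) by
        rw [← Real.sin_neg]; ring_nf,
      show Real.sin (A - 2 * B) = -Real.sin ((3 * B - A) - B) by
        rw [← Real.sin_neg]; ring_nf,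
      show Real.sin (A - 4 * B) = -Real.sin ((3 * B - A) + B) by
        rw [← Real.sin_neg]; ring_nf]
    simp only [Real.sin_add (3 * B - A), Real.sin_sub (3 * B - A)]
    ring
  have low' : 0 < 2 * Real.sin (3 * B - A) *
        (Real.cos (3 * B - 2 * A) + Real.cos (B - 2 * A) + Real.cos B) :=
    mul_pos (by linarith) (by linarith)
  constructor <;> linarith

/-! ### The paths close to edge 0: F, R, X₂, X₃, Y₂, Y₃ -/

namespace IsFrame

variable {a b : ℂ} {A B κ : ℝ} (h : IsFrame a b A B κ)
include h

/-- Edge 3 has inclination π/2 - A, so slope -A is at a right angle to it and the bounce reverses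
the line. In the same way slope -B is at a right angle to edge 1. -/
lemma perpendicular_start (m : ℝ) :
    bounce (quad a b) 3 (-rightward (-A) (-m)) = rightward (-A) (-m) := by
  rw [neg_rightward, h.bounce_three]
  congr 1 <;> ring

lemma perpendicular_end_three (m : ℝ) :
    bounce (quad a b) 3 (leftward (-A) m) = -leftward (-A) m := by
  rw [neg_leftward, h.bounce_three]
  congr 1
  ring

lemma perpendicular_end_one (m : ℝ) :
    bounce (quad a b) 1 (rightward (-B) m) = -rightward (-B) m := by
  rw [neg_rightward, h.bounce_one]
  have : -(2 * B) - -B = -B := by ring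
  rw [this]
  congr 1
  ring

/-- The Fagnano path of the triangle formed by three edges, two of whose angles are acute. -/
lemma hasBasicPath_of_acute_acute (hA : 0 < A) (hB : B < 0) (hA' : A ≤ κ / 200)
    (hB' : -B ≤ κ / 200) (hκ : κ ≤ 1) : HasBasicPath (quad a b) := by
  have hpi := Real.pi_gt_three
  have sA : 0 < Real.sin A := Real.sin_pos_of_pos_of_lt_pi hA (by linarith)
  have sB : Real.sin B < 0 := Real.sin_neg_of_neg_of_neg_pi_lt hB (by linarith)
  have cA : 0 < Real.cos A := Real.cos_pos_of_mem_Ioo ⟨by linarith, by linarith⟩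
  have cB : 0 < Real.cos B := Real.cos_pos_of_mem_Ioo ⟨by linarith, by linarith⟩
  have s1 : Real.sin (A - B) = Real.sin A * Real.cos B - Real.cos A * Real.sin B :=
    Real.sin_sub A B
  have s2 : Real.sin (A + B) = Real.sin A * Real.cos B + Real.cos A * Real.sin B :=
    Real.sin_add A B
  have p1 : 0 < Real.sin A * Real.cos B := mul_pos sA cB
  have p2 : Real.cos A * Real.sin B < 0 := mul_neg_of_pos_of_neg cA sB
  obtain ⟨-, b1⟩ := abs_sin_le_of_abs_le (x := A - B) (t := κ / 100)
    (by rw [abs_le]; constructor <;> linarith)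
  -- Three bounces send a moment `m` to sin (A - B) + sin (A + B) - m; this is the fixed point.
  set μ := Real.sin A * Real.cos B with hμ
  have hf : Follows (quad a b) (leftward (-(A + B)) μ) [3, 0, 1] (leftward (-(A + B)) μ) := by
    refine h.step_three (ψ' := -(A - B)) (m' := -μ) (by ring) rfl (by linarith)
      (by rw [abs_le]; constructor <;> linarith) (by rw [abs_le]; constructor <;> linarith) ?_
    refine step_zero (by linarith) (by rw [neg_neg, neg_neg]; linarith) ?_
    refine h.step_one (ψ' := -(A + B)) (m' := μ) (by ring) ?_ ?_
      (by rw [abs_le]; constructor <;> linarith) (by rw [abs_le]; constructor <;> linarith)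
      (Follows.nil _)
    · rw [neg_neg, Real.sin_neg, neg_neg]; linarith
    · rw [Real.sin_neg]; linarith
  -- The path closes up after three bounces and is run through twice to make the length even.
  exact (hf.append hf).hasBasicPath (U := [0, 1, 2, 0, 1, 2]) h.convex (by simp [basicOrbitTypes])
    (by simp) (by decide) 3 (by decide)

/-- A line at a right angle to edge `3` leaves it close to vertex `0`. -/
lemma leaves_start {μ : ℝ} (hA' : |A| ≤ κ / 200) (h0 : 0 < μ) (hμ : μ < Real.sin A) :
    Leaves (quad a b) 3 (rightward (-A) (-μ)) := by
  obtain ⟨-, b1⟩ := abs_sin_le_of_abs_le hA'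
  have := abs_le.1 hA'
  refine h.leaves_three (by linarith) ?_ ?_ <;> rw [abs_le] <;> constructor <;> linarith

lemma follows_start {μ : ℝ} (hA' : |A| ≤ κ / 200) (hB' : |B| ≤ κ / 200) (h0 : 0 < μ)
    (hμ : μ < Real.sin A) :
    Follows (quad a b) (rightward (-A) (-μ)) [0, 1]
      (leftward (-(A + 2 * B)) (Real.sin A + Real.sin (A + 2 * B) - μ)) := by
  obtain ⟨a1, a2⟩ := abs_le.1 hA'
  obtain ⟨a3, a4⟩ := abs_le.1 hB'
  obtain ⟨b1, b2⟩ := abs_sin_le_of_abs_le hA'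
  obtain ⟨b3, b4⟩ := abs_sin_le_of_abs_le (x := A + 2 * B) (t := 3 * κ / 200)
    (by rw [abs_le]; constructor <;> linarith)
  refine step_zero (by linarith) (by rwa [neg_neg, neg_neg]) ?_
  refine h.step_one (by ring) ?_ ?_ ?_ ?_ (Follows.nil _)
  · rw [neg_neg, neg_neg, Real.sin_neg]; ring
  · rw [Real.sin_neg]; linarith
  all_goals rw [abs_le]; constructor <;> linarith

/-- The initial part of the longer paths, up to the fourth bounce. -/
lemma follows_start_long {μ : ℝ} (hA' : |A| ≤ κ / 200) (hB' : |B| ≤ κ / 200) (h0 : 0 < μ)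
    (hμ : μ < Real.sin A) (hA0 : 0 < Real.sin A + Real.sin (A + 2 * B) - μ)
    (hAB : Real.sin (A - 2 * B) < Real.sin A + Real.sin (A + 2 * B) - μ) :
    Follows (quad a b) (rightward (-A) (-μ)) [0, 1, 3, 1]
      (leftward (A - 4 * B) (Real.sin A + Real.sin (A + 2 * B) - Real.sin (A - 2 * B) -
        Real.sin (A - 4 * B) - μ)) := by
  obtain ⟨a1, a2⟩ := abs_le.1 hA'
  obtain ⟨a3, a4⟩ := abs_le.1 hB'
  obtain ⟨b1, b2⟩ := abs_sin_le_of_abs_le hA'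
  obtain ⟨b3, b4⟩ := abs_sin_le_of_abs_le (x := A + 2 * B) (t := 3 * κ / 200)
    (by rw [abs_le]; constructor <;> linarith)
  obtain ⟨b5, b6⟩ := abs_sin_le_of_abs_le (x := A - 2 * B) (t := 3 * κ / 200)
    (by rw [abs_le]; constructor <;> linarith)
  obtain ⟨b7, b8⟩ := abs_sin_le_of_abs_le (x := A - 4 * B) (t := 5 * κ / 200)
    (by rw [abs_le]; constructor <;> linarith)
  refine (h.follows_start hA' hB' h0 hμ).append ?_
  refine h.step_three (ψ' := -(A - 2 * B)) (by ring) rfl (by linarith) ?_ ?_ ?_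
  · rw [abs_le]; constructor <;> linarith
  · rw [abs_le]; constructor <;> linarith
  refine h.step_one (by ring) ?_ ?_ ?_ ?_ (Follows.nil _)
  · rw [Real.sin_neg]; ring
  · linarith
  all_goals rw [abs_le]; constructor <;> linarith

/-- The final part of the longer paths. -/
lemma follows_end {m : ℝ} (hA' : |A| ≤ κ / 200) (hB' : |B| ≤ κ / 200)
    (hm' : |m| ≤ κ / 2) (hm : m < Real.sin (3 * A - 4 * B)) (h1 : 0 < Real.sin (3 * A - 2 * B))
    (h2 : 0 < Real.sin (A - 2 * B)) :
    Follows (quad a b) (rightward (3 * A - 4 * B) m) [1, 3, 1]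
      (leftward (-A) (Real.sin (3 * A - 4 * B) + Real.sin (3 * A - 2 * B) + Real.sin (A - 2 * B) +
        Real.sin A - m)) := by
  obtain ⟨a1, a2⟩ := abs_le.1 hA'
  obtain ⟨a3, a4⟩ := abs_le.1 hB'
  obtain ⟨a5, a6⟩ := abs_le.1 hm'
  obtain ⟨b1, b2⟩ := abs_sin_le_of_abs_le hA'
  obtain ⟨b3, b4⟩ := abs_sin_le_of_abs_le (x := 3 * A - 2 * B) (t := 5 * κ / 200)
    (by rw [abs_le]; constructor <;> linarith)
  obtain ⟨b5, b6⟩ := abs_sin_le_of_abs_le (x := A - 2 * B) (t := 3 * κ / 200)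
    (by rw [abs_le]; constructor <;> linarith)
  obtain ⟨b7, b8⟩ := abs_sin_le_of_abs_le (x := 3 * A - 4 * B) (t := 7 * κ / 200)
    (by rw [abs_le]; constructor <;> linarith)
  refine h.step_one (ψ' := -(3 * A - 2 * B))
    (m' := Real.sin (3 * A - 4 * B) + Real.sin (3 * A - 2 * B) - m) (by ring) ?_ ?_ ?_ ?_ ?_
  · rw [Real.sin_neg]; ring
  · rw [Real.sin_neg]; linarith
  · rw [abs_le]; constructor <;> linarith
  · rw [abs_le]; constructor <;> linarith
  refine h.step_three (ψ' := A - 2 * B) (by ring) rfl (by linarith) ?_ ?_ ?_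
  · rw [abs_le]; constructor <;> linarith
  · rw [abs_le]; constructor <;> linarith
  refine h.step_one (by ring) ?_ ?_ ?_ ?_ (Follows.nil _)
  · rw [Real.sin_neg]; ring
  · rw [Real.sin_neg]; linarith
  all_goals rw [abs_le]; constructor <;> linarith

lemma leaves_end_three {m : ℝ} (hA' : |A| ≤ κ / 200) (hm : 0 < m) (hm' : |m| ≤ κ) :
    Leaves (quad a b) 3 (-leftward (-A) m) := by
  have := abs_nonneg A
  rw [neg_leftward]
  exact h.leaves_three (by linarith) (by rw [abs_neg]; linarith) (by rwa [abs_neg])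

/-- A path next to the right angle at the vertex `1`. -/
lemma hasBasicPath_of_right (hA : 0 < A) (hB : B = 0) (hA' : A ≤ κ / 200) (hκ : κ ≤ 1) :
    HasBasicPath (quad a b) := by
  have hpi := Real.pi_gt_three
  subst hB
  have hA'' : |A| ≤ κ / 200 := by rwa [abs_of_pos hA]
  have sA : 0 < Real.sin A := Real.sin_pos_of_pos_of_lt_pi hA (by linarith)
  obtain ⟨b1, b2⟩ := abs_sin_le_of_abs_le hA''
  have hf := h.follows_start hA'' (by simpa using (by linarith : (0 : ℝ) ≤ κ / 200))
    (half_pos sA) (half_lt_self sA)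
  rw [mul_zero, add_zero] at hf
  have h3 := h.leaves_end_three (m := Real.sin A + Real.sin A - Real.sin A / 2) hA'' (by linarith)
    (by rw [abs_le]; constructor <;> linarith)
  have hs := h.leaves_start hA'' (half_pos sA) (half_lt_self sA)
  -- Since B = 0, the slope after the bounces 0, 1 is -A again and the path turns back at edge 3.
  -- The initial bounce off edge 3 is counted first, which gives the word 301310.
  have hc := Follows.step (h.perpendicular_start _) hs
    (hf.append (Follows.step (h.perpendicular_end_three _) h3 hf.reverse))
  exact hc.hasBasicPath (U := [0, 1, 2, 0, 2, 1]) h.convex (by simp [basicOrbitTypes])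
    (by simp) (by decide) 3 (by decide)

/-- Closing up the paths that end at a right angle to edge `3`. -/
lemma closed_of_follows {μ m : ℝ} {W : List (Fin 4)} (hA' : |A| ≤ κ / 200) (h0 : 0 < μ)
    (hμ : μ < Real.sin A) (hf : Follows (quad a b) (rightward (-A) (-μ)) W (leftward (-A) m))
    (hm : 0 < m) (hm' : |m| ≤ κ) :
    Follows (quad a b) (rightward (-A) (-μ)) (W ++ 3 :: (W.reverse ++ [3])) (rightward (-A) (-μ)) :=
  Follows.closed_of_perpendicular (h.perpendicular_start μ) (h.leaves_start hA' h0 hμ) hf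
    (h.perpendicular_end_three m) (h.leaves_end_three hA' hm hm')

/-- After the bounces 0, 1, 3 the slope is -(A - 2B) = -B, so the path meets edge 1 at a right angle
and turns back. Half of sin A is merely a convenient value of the first distance. -/
lemma hasBasicPath_of_ratio_third (hA : 0 < A) (hB : A = 3 * B) (hA' : A ≤ κ / 200) (hκ : κ ≤ 1) :
    HasBasicPath (quad a b) := by
  have hpi := Real.pi_gt_three
  have hB0 : 0 < B := by linarith
  have hA'' : |A| ≤ κ / 200 := by rwa [abs_of_pos hA]
  have hB'' : |B| ≤ κ / 200 := by rw [abs_of_pos hB0]; linarith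
  have sA : 0 < Real.sin A := Real.sin_pos_of_pos_of_lt_pi hA (by linarith)
  have sAB : Real.sin B < Real.sin (A + 2 * B) :=
    Real.sin_lt_sin_of_lt_of_le_pi_div_two (by linarith) (by linarith) (by linarith)
  have sB : 0 < Real.sin B := Real.sin_pos_of_pos_of_lt_pi hB0 (by linarith)
  obtain ⟨b1, b2⟩ := abs_sin_le_of_abs_le hA''
  obtain ⟨b3, b4⟩ := abs_sin_le_of_abs_le (x := A + 2 * B) (t := 3 * κ / 200)
    (by rw [abs_le]; constructor <;> linarith)
  set m := Real.sin A + Real.sin (A + 2 * B) - Real.sin A / 2 with hm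
  have hf : Follows (quad a b) (rightward (-A) (-(Real.sin A / 2))) [0, 1, 3]
      (rightward (-B) (-m)) := by
    refine (h.follows_start hA'' hB'' (half_pos sA) (half_lt_self sA)).append ?_
    refine h.step_three (by linarith) rfl (by linarith) ?_ ?_ (Follows.nil _) <;>
      rw [abs_le] <;> constructor <;> linarith
  have hl : Leaves (quad a b) 1 (-rightward (-B) (-m)) := by
    rw [neg_rightward, neg_neg]
    refine h.leaves_one ?_ ?_ ?_
    · rw [Real.sin_neg]; linarith
    all_goals rw [abs_le]; constructor <;> linarith
  have hc := Follows.closed_of_perpendicular (h.perpendicular_start _)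
    (h.leaves_start hA'' (half_pos sA) (half_lt_self sA)) hf (h.perpendicular_end_one _) hl
  exact hc.hasBasicPath (U := [0, 1, 3, 1, 3, 1, 0, 3]) h.convex (by simp [basicOrbitTypes])
    (by simp) (by decide) 0 (by decide)

/-- After the bounces 0, 1, 3, 1 the slope is A - 4B = -A, so the path meets edge 3 at a right angle
and turns back. -/
lemma hasBasicPath_of_ratio_half (hA : 0 < A) (hB : A = 2 * B) (hA' : A ≤ κ / 200) (hκ : κ ≤ 1) :
    HasBasicPath (quad a b) := by
  have hpi := Real.pi_gt_three
  have hB0 : 0 < B := by linarith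
  have hA'' : |A| ≤ κ / 200 := by rwa [abs_of_pos hA]
  have hB'' : |B| ≤ κ / 200 := by rw [abs_of_pos hB0]; linarith
  have sA : 0 < Real.sin A := Real.sin_pos_of_pos_of_lt_pi hA (by linarith)
  have sAB : 0 < Real.sin (A + 2 * B) :=
    Real.sin_pos_of_pos_of_lt_pi (by linarith) (by linarith)
  have e1 : A - 2 * B = 0 := by linarith
  have e2 : A - 4 * B = -A := by linarith
  obtain ⟨b1, b2⟩ := abs_sin_le_of_abs_le hA''
  obtain ⟨b3, b4⟩ := abs_sin_le_of_abs_le (x := A + 2 * B) (t := 3 * κ / 200)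
    (by rw [abs_le]; constructor <;> linarith)
  have hf := h.follows_start_long hA'' hB'' (half_pos sA) (half_lt_self sA) (by linarith)
    (by rw [e1, Real.sin_zero]; linarith)
  rw [e1, e2, Real.sin_neg, Real.sin_zero] at hf
  have hc := h.closed_of_follows hA'' (half_pos sA) (half_lt_self sA) hf (by linarith)
    (by rw [abs_le]; constructor <;> linarith)
  exact hc.hasBasicPath (U := [0, 1, 3, 1, 3, 1, 3, 1, 0, 3]) h.convex (by simp [basicOrbitTypes])
    (by simp) (by decide) 0 (by decide)

/-- The bounces 0, 1, 3, 1, 3, 0, 1, 3, 1 bring the slope back to -A for any A and B. The two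
bounces off edge 0 require 0 < μ < sin A and 0 < S - μ < sin (3A - 4B). These are compatible because
S - sin (3A - 4B) < sin A, which by `key` reduces to 2B < 2A - 4B. -/
lemma hasBasicPath_of_ratio_lt_third (hB : 0 < B) (hAB : 3 * B < A) (hA' : A ≤ κ / 200)
    (hκ : κ ≤ 1) : HasBasicPath (quad a b) := by
  have hpi := Real.pi_gt_three
  have hA : 0 < A := by linarith
  have hA'' : |A| ≤ κ / 200 := by rwa [abs_of_pos hA]
  have hB'' : |B| ≤ κ / 200 := by rw [abs_of_pos hB]; linarith
  have s1 : 0 < Real.sin A := Real.sin_pos_of_pos_of_lt_pi hA (by linarith)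
  have s2 : 0 < Real.sin (3 * A - 4 * B) :=
    Real.sin_pos_of_pos_of_lt_pi (by linarith) (by linarith)
  have s3 : 0 < Real.sin (3 * A - 2 * B) :=
    Real.sin_pos_of_pos_of_lt_pi (by linarith) (by linarith)
  have s4 : 0 < Real.sin (A - 2 * B) :=
    Real.sin_pos_of_pos_of_lt_pi (by linarith) (by linarith)
  have s5 : Real.sin (A - 2 * B) < Real.sin (A + 2 * B) :=
    Real.sin_lt_sin_of_lt_of_le_pi_div_two (by linarith) (by linarith) (by linarith)
  have s6 : Real.sin (A - 4 * B) < Real.sin A :=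
    Real.sin_lt_sin_of_lt_of_le_pi_div_two (by linarith) (by linarith) (by linarith)
  have s7 : Real.sin (2 * B) < Real.sin (2 * A - 4 * B) :=
    Real.sin_lt_sin_of_lt_of_le_pi_div_two (by linarith) (by linarith) (by linarith)
  have cA : 0 < Real.cos A := Real.cos_pos_of_mem_Ioo ⟨by linarith, by linarith⟩
  have key : Real.sin (3 * A - 4 * B) + Real.sin (A - 4 * B) + Real.sin (A - 2 * B) -
      Real.sin (A + 2 * B) = 2 * Real.cos A * (Real.sin (2 * A - 4 * B) - Real.sin (2 * B)) := by
    rw [show 3 * A - 4 * B = (2 * A - 4 * B) + A by ring,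
      show A - 4 * B = (2 * A - 4 * B) - A by ring]
    simp only [Real.sin_add, Real.sin_sub A (2 * B), Real.sin_sub (2 * A - 4 * B) A]
    ring
  have key' : 0 < 2 * Real.cos A * (Real.sin (2 * A - 4 * B) - Real.sin (2 * B)) :=
    mul_pos (by linarith) (by linarith)
  obtain ⟨b1, b2⟩ := abs_sin_le_of_abs_le hA''
  obtain ⟨b3, b4⟩ := abs_sin_le_of_abs_le (x := A + 2 * B) (t := 3 * κ / 200)
    (by rw [abs_le]; constructor <;> linarith)
  obtain ⟨b5, b6⟩ := abs_sin_le_of_abs_le (x := A - 2 * B) (t := 3 * κ / 200)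
    (by rw [abs_le]; constructor <;> linarith)
  obtain ⟨b7, b8⟩ := abs_sin_le_of_abs_le (x := A - 4 * B) (t := 5 * κ / 200)
    (by rw [abs_le]; constructor <;> linarith)
  obtain ⟨b9, b10⟩ := abs_sin_le_of_abs_le (x := 3 * A - 4 * B) (t := 7 * κ / 200)
    (by rw [abs_le]; constructor <;> linarith)
  obtain ⟨b11, b12⟩ := abs_sin_le_of_abs_le (x := 3 * A - 2 * B) (t := 5 * κ / 200)
    (by rw [abs_le]; constructor <;> linarith)
  set S := Real.sin A + Real.sin (A + 2 * B) - Real.sin (A - 2 * B) - Real.sin (A - 4 * B) with hS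
  obtain ⟨μ, hμ1, hμ2⟩ : ∃ μ, max 0 (S - Real.sin (3 * A - 4 * B)) < μ ∧ μ < min (Real.sin A) S := by
    apply exists_between
    rw [max_lt_iff, lt_min_iff, lt_min_iff]
    refine ⟨⟨?_, ?_⟩, ?_, ?_⟩ <;> linarith
  rw [max_lt_iff] at hμ1
  rw [lt_min_iff] at hμ2
  have hf := h.follows_start_long hA'' hB'' hμ1.1 hμ2.1 (by linarith) (by linarith)
  rw [← hS] at hf
  have hm : |S - μ| ≤ κ / 2 := by rw [abs_le]; constructor <;> linarith
  have hg : Follows (quad a b) (leftward (A - 4 * B) (S - μ)) [3, 0]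
      (rightward (3 * A - 4 * B) (S - μ)) := by
    refine h.step_three (ψ' := -(3 * A - 4 * B)) (by ring) rfl (by linarith) ?_
      (by rw [abs_neg]; linarith [abs_nonneg (S - μ)]) ?_
    · rw [abs_le]; constructor <;> linarith
    refine step_zero (by linarith) (by rw [neg_neg, neg_neg]; linarith) ?_
    rw [neg_neg, neg_neg]
    exact Follows.nil _
  have hk := (hf.append hg).append (h.follows_end hA'' hB'' hm (by linarith) s3 s4)
  have hc := h.closed_of_follows hA'' hμ1.1 hμ2.1 hk (by linarith)
    (by rw [abs_le]; constructor <;> linarith)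
  exact hc.hasBasicPath (U := [0, 1, 3, 1, 3, 0, 1, 3, 1, 3, 1, 3, 1, 0, 3, 1, 3, 1, 0, 3]) h.convex
    (by simp [basicOrbitTypes]) (by simp) (by decide) 0 (by decide)

/-- Compared with the path for 3B < A, there is one more round trip between edges 3 and 1 on either
side of the second bounce off edge 0, which now takes place with slope 5A - 6B. -/
lemma hasBasicPath_of_ratio_lt_half (hB : A < 3 * B) (hAB : 2 * B < A) (hA' : A ≤ κ / 200)
    (hκ : κ ≤ 1) : HasBasicPath (quad a b) := by
  have hpi := Real.pi_gt_three
  have hA : 0 < A := by linarith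
  have hA'' : |A| ≤ κ / 200 := by rwa [abs_of_pos hA]
  have hB'' : |B| ≤ κ / 200 := by rw [abs_of_pos (by linarith)]; linarith
  have s1 : 0 < Real.sin A := Real.sin_pos_of_pos_of_lt_pi hA (by linarith)
  have s2 : 0 < Real.sin (3 * A - 4 * B) :=
    Real.sin_pos_of_pos_of_lt_pi (by linarith) (by linarith)
  have s3 : 0 < Real.sin (3 * A - 2 * B) :=
    Real.sin_pos_of_pos_of_lt_pi (by linarith) (by linarith)
  have s4 : 0 < Real.sin (A - 2 * B) :=
    Real.sin_pos_of_pos_of_lt_pi (by linarith) (by linarith)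
  have s5 : Real.sin (A - 2 * B) < Real.sin (A + 2 * B) :=
    Real.sin_lt_sin_of_lt_of_le_pi_div_two (by linarith) (by linarith) (by linarith)
  have s6 : Real.sin (A - 4 * B) < 0 :=
    Real.sin_neg_of_neg_of_neg_pi_lt (by linarith) (by linarith)
  have s10 : 0 < Real.sin (5 * A - 6 * B) :=
    Real.sin_pos_of_pos_of_lt_pi (by linarith) (by linarith)
  have s11 : 0 < Real.sin (5 * A - 4 * B) :=
    Real.sin_pos_of_pos_of_lt_pi (by linarith) (by linarith)
  obtain ⟨low, key⟩ := sin_sums_of_ratio_lt_half hB hAB (by linarith)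
  have s12 : 0 < Real.sin (3 * A - 6 * B) :=
    Real.sin_pos_of_pos_of_lt_pi (by linarith) (by linarith)
  obtain ⟨b1, b2⟩ := abs_sin_le_of_abs_le hA''
  obtain ⟨b3, b4⟩ := abs_sin_le_of_abs_le (x := A + 2 * B) (t := 3 * κ / 200)
    (by rw [abs_le]; constructor <;> linarith)
  obtain ⟨b5, b6⟩ := abs_sin_le_of_abs_le (x := A - 2 * B) (t := 3 * κ / 200)
    (by rw [abs_le]; constructor <;> linarith)
  obtain ⟨b7, b8⟩ := abs_sin_le_of_abs_le (x := A - 4 * B) (t := 5 * κ / 200)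
    (by rw [abs_le]; constructor <;> linarith)
  obtain ⟨b9, b10⟩ := abs_sin_le_of_abs_le (x := 3 * A - 4 * B) (t := 7 * κ / 200)
    (by rw [abs_le]; constructor <;> linarith)
  obtain ⟨b11, b12⟩ := abs_sin_le_of_abs_le (x := 3 * A - 2 * B) (t := 5 * κ / 200)
    (by rw [abs_le]; constructor <;> linarith)
  obtain ⟨b13, b14⟩ := abs_sin_le_of_abs_le (x := 3 * A - 6 * B) (t := 9 * κ / 200)
    (by rw [abs_le]; constructor <;> linarith)
  obtain ⟨b15, b16⟩ := abs_sin_le_of_abs_le (x := 5 * A - 6 * B) (t := 11 * κ / 200)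
    (by rw [abs_le]; constructor <;> linarith)
  obtain ⟨b17, b18⟩ := abs_sin_le_of_abs_le (x := 5 * A - 4 * B) (t := 9 * κ / 200)
    (by rw [abs_le]; constructor <;> linarith)
  set S := Real.sin A + Real.sin (A + 2 * B) - Real.sin (A - 2 * B) - Real.sin (A - 4 * B) with hS
  set T := S - Real.sin (3 * A - 4 * B) - Real.sin (3 * A - 6 * B) with hT
  -- The bounces off edge 0 require 0 < μ < sin A and 0 < T - μ < sin (5A - 6B).
  obtain ⟨μ, hμ1, hμ2⟩ : ∃ μ, max 0 (T - Real.sin (5 * A - 6 * B)) < μ ∧ μ < min (Real.sin A) T := by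
    apply exists_between
    rw [max_lt_iff, lt_min_iff, lt_min_iff]
    refine ⟨⟨?_, ?_⟩, ?_, ?_⟩ <;> linarith
  obtain ⟨hμ0, hμT⟩ := max_lt_iff.1 hμ1
  obtain ⟨hμA, hμT'⟩ := lt_min_iff.1 hμ2
  have hf := h.follows_start_long hA'' hB'' hμ0 hμA (by linarith) (by linarith)
  rw [← hS] at hf
  have hg : Follows (quad a b) (leftward (A - 4 * B) (S - μ)) [3, 1, 3, 0]
      (rightward (5 * A - 6 * B) (T - μ)) := by
    refine h.step_three (ψ' := -(3 * A - 4 * B)) (by ring) rfl (by linarith) ?_ ?_ ?_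
    · rw [abs_le]; constructor <;> linarith
    · rw [abs_le]; constructor <;> linarith
    refine h.step_one (ψ' := 3 * A - 6 * B) (m' := T - μ) (by ring) ?_ (by linarith) ?_ ?_ ?_
    · rw [Real.sin_neg]; linarith
    · rw [abs_le]; constructor <;> linarith
    · rw [abs_le]; constructor <;> linarith
    refine h.step_three (ψ' := -(5 * A - 6 * B)) (by ring) rfl (by linarith) ?_ ?_ ?_
    · rw [abs_le]; constructor <;> linarith
    · rw [abs_le]; constructor <;> linarith
    refine step_zero (by linarith) (by rw [neg_neg, neg_neg]; linarith) ?_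
    rw [neg_neg, neg_neg]
    exact Follows.nil _
  set m := Real.sin (5 * A - 6 * B) + Real.sin (5 * A - 4 * B) - (T - μ) with hm
  have hg' : Follows (quad a b) (rightward (5 * A - 6 * B) (T - μ)) [1, 3]
      (rightward (3 * A - 4 * B) (-m)) := by
    refine h.step_one (ψ' := -(5 * A - 4 * B)) (m' := m) (by ring) ?_ ?_ ?_ ?_ ?_
    · rw [Real.sin_neg]; linarith
    · rw [Real.sin_neg]; linarith
    · rw [abs_le]; constructor <;> linarith
    · rw [abs_le]; constructor <;> linarith
    refine h.step_three (by ring) rfl (by linarith) ?_ ?_ (Follows.nil _)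
    · rw [abs_le]; constructor <;> linarith
    · rw [abs_le]; constructor <;> linarith
  have hm' : |-m| ≤ κ / 2 := by rw [abs_le]; constructor <;> linarith
  have hk := ((hf.append hg).append hg').append (h.follows_end hA'' hB'' hm' (by linarith) s3 s4)
  have hc := h.closed_of_follows hA'' hμ0 hμA hk (by linarith)
    (by rw [abs_le]; constructor <;> linarith)
  exact hc.hasBasicPath (U := [0, 1, 3, 1, 3, 1, 3, 0, 1, 3, 1, 3, 1, 3, 1, 3, 1, 3, 1, 0, 3, 1, 3,
    1, 3, 1, 0, 3]) h.convex (by simp [basicOrbitTypes]) (by simp) (by decide) 0 (by decide)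

/-- The angle at vertex `1` exceeds a right angle by at most half of the amount by which the angle
at vertex `0` falls short of it. -/
lemma hasBasicPath_of_two_mul_le (hA : 0 < A) (hB : 2 * B ≤ A) (hA' : |A| ≤ κ / 200)
    (hB' : |B| ≤ κ / 200) (hκ : κ ≤ 1) : HasBasicPath (quad a b) := by
  have h1 := (abs_le.1 hA').2
  have h2 := (abs_le.1 hB').1
  rcases lt_trichotomy B 0 with h0 | h0 | h0
  · exact h.hasBasicPath_of_acute_acute hA h0 h1 (by linarith) hκ
  · exact h.hasBasicPath_of_right hA h0 h1 hκ
  rcases lt_trichotomy A (3 * B) with h3 | h3 | h3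
  · rcases hB.lt_or_eq with h4 | h4
    · exact h.hasBasicPath_of_ratio_lt_half h3 h4 h1 hκ
    · exact h.hasBasicPath_of_ratio_half hA h4.symm h1 hκ
  · exact h.hasBasicPath_of_ratio_third hA h3 h1 hκ
  · exact h.hasBasicPath_of_ratio_lt_third h0 h3 h1 hκ

end IsFrame

/-! ### The path A along a diagonal -/

/-- The slopes of edges `1`, `2`, `3` of the quadrilateral `0, 1, a, b`, together with the fact that
lines nearly parallel to the diagonal from `0` to `a` and passing near one of its endpoints stay
away from the other two vertices. -/
structure IsDiagonalFrame (a b : ℂ) (A B τ κ : ℝ) : Prop where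
  mirror_three : ∀ d, mirror (edgeVec (quad a b) 3) d =
    -Complex.exp (-(2 * A) * Complex.I) * conj d
  mirror_one : ∀ d, mirror (edgeVec (quad a b) 1) d =
    -Complex.exp (-(2 * B) * Complex.I) * conj d
  mirror_two : ∀ d, mirror (edgeVec (quad a b) 2) d =
    Complex.exp (2 * τ * Complex.I) * conj d
  far_zero : ∀ θ m : ℝ, |θ| ≤ κ → |m| ≤ κ →
    Complex.normSq a * m < cross 1 (a * Complex.exp (θ * Complex.I))
  far_one : ∀ θ m : ℝ, |θ| ≤ κ → |m| ≤ κ →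
    Complex.normSq a * m < -cross (a - 1) (a * Complex.exp (θ * Complex.I))
  far_two : ∀ θ m : ℝ, |θ| ≤ κ → |m| ≤ κ →
    Complex.normSq a * m < -cross (b - a) (a * Complex.exp (θ * Complex.I))
  far_three : ∀ θ m : ℝ, |θ| ≤ κ → |m| ≤ κ →
    Complex.normSq a * m < -cross b (a * Complex.exp (θ * Complex.I))
  convex : IsPositivelyConvex (quad a b)

lemma cross_mul_exp (a : ℂ) (θ : ℝ) :
    cross a (a * Complex.exp (θ * Complex.I)) = Complex.normSq a * Real.sin θ := by
  have := cross_mul_mul a 1 (Complex.exp (θ * Complex.I))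
  rw [mul_one, cross_one_left, Complex.exp_ofReal_mul_I_im] at this
  exact this

lemma IsPositivelyConvex.edgeVec_ne_zero {V : Fin 4 → ℂ} (h : IsPositivelyConvex V) (i : Fin 4) :
    edgeVec V i ≠ 0 := by
  intro h0
  have := h i
  simp [h0, cross] at this

/-- The moment of a mirrored line, measured at the first endpoint of the edge. -/
lemma step_left {V : Fin 4 → ℂ} {i : Fin 4} {d d' z : ℂ} {m m' r : ℝ} {L : DirectedLine}
    {W : List (Fin 4)} (hd : mirror (edgeVec V i) d = d') (hz : V i = z)
    (hm : cross z d - m = r) (hm' : m' = cross z d' + r) (hr : 0 < r)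
    (hf : r < cross (edgeVec V i) d') (hW : Follows V ⟨d', m'⟩ W L) :
    Follows V ⟨d, m⟩ (i :: W) L := by
  subst hz
  refine Follows.step (y := ⟨d', m'⟩) ?_ ⟨?_, ?_⟩ hW
  · ext1
    · exact hd
    · simp only [bounce, hd]; linarith
  · simp only; linarith
  · rw [cross_next]; simp only; linarith

/-- The moment of a mirrored line, measured at the second endpoint of the edge. -/
lemma step_right {V : Fin 4 → ℂ} {i : Fin 4} {d d' z : ℂ} {m m' r : ℝ} {L : DirectedLine}
    {W : List (Fin 4)} (hd : mirror (edgeVec V i) d = d') (hz : V (i + 1) = z)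
    (hi : edgeVec V i ≠ 0) (hm : m - cross z d = r) (hm' : m' = cross z d' - r) (hr : 0 < r)
    (hf : r < cross (edgeVec V i) d') (hW : Follows V ⟨d', m'⟩ W L) :
    Follows V ⟨d, m⟩ (i :: W) L := by
  subst hz
  have h2 := cross_mirror hi d
  rw [hd] at h2
  rw [cross_next] at hm hm'
  refine Follows.step (y := ⟨d', m'⟩) ?_ ⟨?_, ?_⟩ hW
  · ext1
    · exact hd
    · simp only [bounce, hd]; linarith
  · simp only; linarith
  · rw [cross_next]; simp only; linarith

namespace IsDiagonalFrame

variable {a b : ℂ} {A B τ κ : ℝ} (h : IsDiagonalFrame a b A B τ κ)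
include h

/-- If the angles at the vertices `0` and `2` are acute, there is a closed path that stays close to
the diagonal joining them. -/
lemma hasBasicPath (hA : 0 < A) (hC : 0 < B + τ) (hA' : |A| ≤ κ / 2) (hC' : |B + τ| ≤ κ / 2)
    (hκ : κ ≤ 1) : HasBasicPath (quad a b) := by
  have hpi := Real.pi_gt_three
  -- `C` is the amount by which the angle at vertex 2 falls short of a right angle.
  obtain ⟨C, rfl⟩ : ∃ C, τ = C - B := ⟨B + τ, by ring⟩
  rw [add_sub_cancel] at hC hC'
  obtain ⟨a1, a2⟩ := abs_le.1 hA'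
  obtain ⟨a3, a4⟩ := abs_le.1 hC'
  set N := Complex.normSq a with hN
  have hN0 : 0 < N := by
    refine Complex.normSq_pos.2 fun h0 => ?_
    have := h.far_zero 0 0 (by simp; linarith) (by simp; linarith)
    simp [h0, cross] at this
  have sA : 0 < Real.sin A := Real.sin_pos_of_pos_of_lt_pi hA (by linarith)
  have sC : 0 < Real.sin C := Real.sin_pos_of_pos_of_lt_pi hC (by linarith)
  have cA : 0 < Real.cos A := Real.cos_pos_of_mem_Ioo ⟨by linarith, by linarith⟩
  have cC : 0 < Real.cos C := Real.cos_pos_of_mem_Ioo ⟨by linarith, by linarith⟩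
  obtain ⟨-, b1⟩ := abs_sin_le_of_abs_le hA'
  obtain ⟨-, b2⟩ := abs_sin_le_of_abs_le hC'
  -- The lines pass at distance |a| p from vertex 0 or |a| q from vertex 2; bounces off the edges at
  -- a corner preserve the distance from it. Comparing moments about both ends of the diagonal
  -- forces p ± q = sin (A ± C).
  set p := Real.sin A * Real.cos C with hp
  set q := Real.cos A * Real.sin C with hq
  have hp0 : 0 < p := mul_pos sA cC
  have hq0 : 0 < q := mul_pos cA sC
  have hp1 : |p| ≤ κ := by
    rw [abs_of_pos hp0]
    nlinarith [mul_le_mul_of_nonneg_left (Real.cos_le_one C) sA.le]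
  have hq1 : |q| ≤ κ := by
    rw [abs_of_pos hq0]
    nlinarith [mul_le_mul_of_nonneg_right (Real.cos_le_one A) sC.le]
  have e1 : Real.sin (A - C) = p - q := Real.sin_sub A C
  have e2 : Real.sin (A + C) = p + q := Real.sin_add A C
  have e3 : Real.sin (C - A) = q - p := by rw [Real.sin_sub]; ring
  have e4 : Real.sin (-(A + C)) = -(p + q) := by rw [Real.sin_neg, e2]
  have t1 : |A - C| ≤ κ := by rw [abs_le]; constructor <;> linarith
  have t2 : |A + C| ≤ κ := by rw [abs_le]; constructor <;> linarith
  have t3 : |C - A| ≤ κ := by rw [abs_le]; constructor <;> linarith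
  have t4 : |-(A + C)| ≤ κ := by rw [abs_le]; constructor <;> linarith
  have f0 := cross_mul_exp a (A - C)
  have f2 := cross_mul_exp a (A + C)
  have f4 := cross_mul_exp a (C - A)
  have f6 := cross_mul_exp a (-(A + C))
  rw [← hN, e1] at f0
  rw [← hN, e2] at f2
  rw [← hN, e3] at f4
  rw [← hN, e4] at f6
  have g1 := h.far_one _ q t1 hq1
  have g2 := h.far_two _ q t2 hq1
  have g3 := h.far_zero _ p t2 hp1
  have g4 := h.far_three _ p t3 hp1
  have g5 := h.far_two _ q t3 hq1
  have g6 := h.far_one _ q t4 hq1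
  have g7 := h.far_three _ p t4 hp1
  have g8 := h.far_zero _ p t1 hp1
  rw [← hN] at g1 g2 g3 g4 g5 g6 g7 g8
  have m0 : ∀ d, mirror (edgeVec (quad a b) 0) d = conj d := by
    simp [edgeVec_quad_zero, mirror]
  have hcm := fun (i : Fin 4) d => cross_mirror (h.convex.edgeVec_ne_zero i) d
  -- `d0`, `-d2`, `d4`, `-d6` are the directions of the four passes along the diagonal. Two bounces
  -- in a corner reverse the path and turn it by ±2C or ±2A. Each corner is visited once in either
  -- sense, so the turns cancel.
  set d0 := a * Complex.exp ((A - C : ℝ) * Complex.I) with hd0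
  set d2 := a * Complex.exp ((A + C : ℝ) * Complex.I) with hd2
  set d4 := a * Complex.exp ((C - A : ℝ) * Complex.I) with hd4
  set d6 := a * Complex.exp ((-(A + C) : ℝ) * Complex.I) with hd6
  set d1 := mirror (edgeVec (quad a b) 1) d0 with hd1
  set d3 := mirror (edgeVec (quad a b) 0) (-d2) with hd3
  set d5 := mirror (edgeVec (quad a b) 2) d4 with hd5
  set d7 := mirror (edgeVec (quad a b) 3) (-d6) with hd7
  have k1 := hcm 1 d0
  have k3 := hcm 0 (-d2)
  have k5 := hcm 2 d4
  have k7 := hcm 3 (-d6)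
  rw [← hd1, edgeVec_quad_one] at k1
  rw [← hd3, edgeVec_quad_zero, cross_neg_right] at k3
  rw [← hd5, edgeVec_quad_two] at k5
  rw [← hd7, edgeVec_quad_three, cross_neg_right, cross_neg_left, cross_neg_left] at k7
  have cexp : ∀ x : ℝ, conj (Complex.exp (-(2 * x) * Complex.I)) = Complex.exp (2 * x * Complex.I) := by
    intro x
    have := conj_exp (-(2 * x))
    push_cast at this
    rw [this, neg_neg]
  have cexp' : ∀ x : ℝ, conj (Complex.exp (2 * x * Complex.I)) = Complex.exp (-(2 * x) * Complex.I) := by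
    intro x
    rw [← cexp, Complex.conj_conj]
  have r2 : mirror (edgeVec (quad a b) 2) d1 = -d2 := by
    have e : Complex.exp (2 * (C - B : ℝ) * Complex.I) * Complex.exp (2 * B * Complex.I) *
        Complex.exp ((A - C : ℝ) * Complex.I) = Complex.exp ((A + C : ℝ) * Complex.I) := by
      rw [← Complex.exp_add, ← Complex.exp_add]
      congr 1
      push_cast
      ring
    rw [hd1, h.mirror_one, h.mirror_two, map_mul, map_neg, cexp, Complex.conj_conj, hd0, hd2, ← e]
    ring
  have r4 : mirror (edgeVec (quad a b) 3) d3 = d4 := by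
    have e : Complex.exp (-(2 * A) * Complex.I) * Complex.exp ((A + C : ℝ) * Complex.I) =
        Complex.exp ((C - A : ℝ) * Complex.I) := by
      rw [← Complex.exp_add]
      congr 1
      push_cast
      ring
    rw [hd3, m0, h.mirror_three, Complex.conj_conj, hd2, hd4, ← e]
    ring
  have r6 : mirror (edgeVec (quad a b) 1) d5 = -d6 := by
    have e : Complex.exp (-(2 * B) * Complex.I) * Complex.exp (-(2 * (C - B : ℝ)) * Complex.I) *
        Complex.exp ((C - A : ℝ) * Complex.I) = Complex.exp ((-(A + C) : ℝ) * Complex.I) := by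
      rw [← Complex.exp_add, ← Complex.exp_add]
      congr 1
      push_cast
      ring
    rw [hd5, h.mirror_one, h.mirror_two, map_mul, cexp', Complex.conj_conj, hd4, hd6, ← e]
    ring
  have r0 : mirror (edgeVec (quad a b) 0) d7 = d0 := by
    have e : Complex.exp (2 * A * Complex.I) * Complex.exp ((-(A + C) : ℝ) * Complex.I) =
        Complex.exp ((A - C : ℝ) * Complex.I) := by
      rw [← Complex.exp_add]
      congr 1
      push_cast
      ring
    rw [hd7, m0, h.mirror_three, map_mul, map_neg, cexp, Complex.conj_conj, hd6, hd0, ← e]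
    ring
  have hf : Follows (quad a b) ⟨d7, -(N * p)⟩ [0, 1, 2, 0, 3, 2, 1, 3] ⟨d7, -(N * p)⟩ := by
    have z0 : quad a b 0 = 0 := rfl
    have z1 : quad a b (1 + 1) = a := rfl
    have z2 : quad a b 2 = a := rfl
    have z3 : quad a b (3 + 1) = 0 := rfl
    have P := mul_pos hN0 hp0
    have Q := mul_pos hN0 hq0
    refine step_left (r := N * p) (m' := N * p) r0 z0 ?_ ?_ P ?_ ?_
    · rw [cross_zero_left]; ring
    · rw [cross_zero_left]; ring
    · rw [edgeVec_quad_zero]; exact g8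
    refine step_right (r := N * q) (d' := d1) (m' := cross a d1 - N * q) rfl z1
      (h.convex.edgeVec_ne_zero 1) ?_ rfl Q ?_ ?_
    · rw [f0]; ring
    · rw [edgeVec_quad_one, k1]; exact g1
    refine step_left (r := N * q) (m' := -(N * p)) r2 z2 ?_ ?_ Q ?_ ?_
    · ring
    · rw [cross_neg_right, f2]; ring
    · rw [edgeVec_quad_two, cross_neg_right]; exact g2
    refine step_left (r := N * p) (d' := d3) (m' := N * p) rfl z0 ?_ ?_ P ?_ ?_
    · rw [cross_zero_left]; ring
    · rw [cross_zero_left]; ring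
    · rw [edgeVec_quad_zero, k3, neg_neg]; exact g3
    refine step_right (r := N * p) (m' := -(N * p)) r4 z3
      (h.convex.edgeVec_ne_zero 3) ?_ ?_ P ?_ ?_
    · rw [cross_zero_left]; ring
    · rw [cross_zero_left]; ring
    · rw [edgeVec_quad_three, cross_neg_left]; exact g4
    refine step_left (r := N * q) (d' := d5) (m' := cross a d5 + N * q) rfl z2 ?_ rfl Q ?_ ?_
    · rw [f4]; ring
    · rw [edgeVec_quad_two, k5]; exact g5
    refine step_right (r := N * q) (m' := N * p) r6 z1
      (h.convex.edgeVec_ne_zero 1) ?_ ?_ Q ?_ ?_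
    · ring
    · rw [cross_neg_right, f6]; ring
    · rw [edgeVec_quad_one, cross_neg_right]; exact g6
    refine step_right (r := N * p) (d' := d7) (m' := -(N * p)) rfl z3
      (h.convex.edgeVec_ne_zero 3) ?_ ?_ P ?_ (Follows.nil _)
    · rw [cross_zero_left]; ring
    · rw [cross_zero_left]; ring
    · rw [edgeVec_quad_three, cross_neg_left]; linarith
  exact hf.hasBasicPath (U := [0, 1, 2, 0, 3, 2, 1, 3]) h.convex (by simp [basicOrbitTypes])
    (by simp) (by decide) 0 (by decide)

end IsDiagonalFrame

/-! ### Corner angles, and perturbations of a rectangle in normal position -/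

open Topology

lemma div_conj_eq_exp {z : ℂ} (hz : z ≠ 0) :
    z / conj z = Complex.exp (2 * z.arg * Complex.I) := by
  have hz' : conj z ≠ 0 := (map_ne_zero _).2 hz
  have hn : (‖z‖ : ℂ) ≠ 0 := by simpa using hz
  have h := Complex.norm_mul_exp_arg_mul_I z
  have h' : conj z = ‖z‖ * Complex.exp (-z.arg * Complex.I) := by
    conv_lhs => rw [← h, map_mul, Complex.conj_ofReal, conj_exp]
  rw [div_eq_iff hz', h', mul_left_comm, ← Complex.exp_add]
  conv_lhs => rw [← h]
  congr 2
  ring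

lemma neg_exp_neg_two_mul (x : ℝ) :
    -Complex.exp (-(2 * (Real.pi / 2 - x : ℝ)) * Complex.I) = Complex.exp (2 * x * Complex.I) := by
  have : (-(2 * (Real.pi / 2 - x : ℝ)) * Complex.I : ℂ) =
      2 * x * Complex.I - Real.pi * Complex.I := by
    push_cast
    ring
  rw [this, Complex.exp_sub_pi_mul_I, neg_neg]

lemma mirror_quad_three {a b : ℂ} (hb : b ≠ 0) (d : ℂ) : mirror (edgeVec (quad a b) 3) d =
    -Complex.exp (-(2 * (Real.pi / 2 - b.arg : ℝ)) * Complex.I) * conj d := by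
  rw [neg_exp_neg_two_mul, ← div_conj_eq_exp hb, edgeVec_quad_three, mirror, map_neg,
    neg_div_neg_eq]

lemma mirror_quad_one {a b : ℂ} (ha : a - 1 ≠ 0) (d : ℂ) : mirror (edgeVec (quad a b) 1) d =
    -Complex.exp (-(2 * (Real.pi / 2 - (a - 1).arg : ℝ)) * Complex.I) * conj d := by
  rw [neg_exp_neg_two_mul, ← div_conj_eq_exp ha, edgeVec_quad_one, mirror]

lemma mirror_quad_two {a b : ℂ} (hab : a - b ≠ 0) (d : ℂ) : mirror (edgeVec (quad a b) 2) d =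
    Complex.exp (2 * (a - b).arg * Complex.I) * conj d := by
  rw [← div_conj_eq_exp hab, edgeVec_quad_two, mirror, ← neg_sub a b, map_neg, neg_div_neg_eq]

/-- The angle of a quadrilateral at vertex `i`. -/
noncomputable def cornerAngle (V : Fin 4 → ℂ) (i : Fin 4) : ℝ :=
  EuclideanGeometry.angle (V (i - 1)) (V i) (V (i + 1))

lemma cornerAngle_quad_zero {a b : ℂ} (hb : 0 < b.im) : cornerAngle (quad a b) 0 = b.arg := by
  have hb0 : b ≠ 0 := by rintro rfl; simp at hb
  change InnerProductGeometry.angle (b - 0) (1 - 0) = _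
  rw [sub_zero, sub_zero, Complex.angle_one_right hb0, abs_of_nonneg (Complex.arg_nonneg_iff.2 hb.le)]

lemma cornerAngle_quad_one {a b : ℂ} (ha : 0 < a.im) :
    cornerAngle (quad a b) 1 = Real.pi - (a - 1).arg := by
  have ha' : 0 < (a - 1).im := by simpa using ha
  have ha0 : a - 1 ≠ 0 := by intro h0; simp [h0] at ha'
  have e : cornerAngle (quad a b) 1 = InnerProductGeometry.angle (quad a b 0 - quad a b 1)
    (quad a b 2 - quad a b 1) := rfl
  have e' : quad a b 0 - quad a b 1 = -1 := zero_sub 1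
  rw [e, e', show quad a b 2 - quad a b 1 = a - 1 from rfl, InnerProductGeometry.angle_neg_left, Complex.angle_one_left ha0,
    abs_of_nonneg (Complex.arg_nonneg_iff.2 ha'.le)]

lemma angle_eq_arg_sub_arg {x y : ℂ} (hx : 0 < x.im) (hy : 0 < y.re) (h : y.arg ≤ x.arg)
    (h' : x.arg - y.arg < Real.pi) : InnerProductGeometry.angle x y = x.arg - y.arg := by
  have hpi := Real.pi_pos
  have hx0 : x ≠ 0 := by rintro rfl; simp at hx
  have hy0 : y ≠ 0 := by rintro rfl; simp at hy
  have hy1 : y.arg ≠ Real.pi := by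
    rw [Ne, Complex.arg_eq_pi_iff]
    rintro ⟨h1, -⟩
    exact lt_asymm h1 hy
  have e : y⁻¹.arg = -y.arg := by rw [Complex.arg_inv, if_neg hy1]
  rw [Complex.angle_eq_abs_arg hx0 hy0, div_eq_mul_inv,
    Complex.arg_mul hx0 (inv_ne_zero hy0) (by rw [e]; constructor <;> linarith), e,
    ← sub_eq_add_neg, abs_of_nonneg (by linarith)]

lemma cornerAngle_quad_two {a b : ℂ} (ha : 0 < a.im) (hab : 0 < (a - b).re)
    (h : (a - b).arg ≤ (a - 1).arg) (h' : (a - 1).arg - (a - b).arg < Real.pi) :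
    cornerAngle (quad a b) 2 = (a - 1).arg - (a - b).arg := by
  change InnerProductGeometry.angle (1 - a) (b - a) = _
  rw [← neg_sub a 1, ← neg_sub a b, InnerProductGeometry.angle_neg_neg]
  exact angle_eq_arg_sub_arg (by simpa using ha) hab h h'

lemma cornerAngle_quad_three {a b : ℂ} (hb : 0 < b.im) (hab : 0 < (a - b).re)
    (h : (a - b).arg ≤ b.arg) (h' : b.arg - (a - b).arg < Real.pi) :
    cornerAngle (quad a b) 3 = Real.pi - (b.arg - (a - b).arg) := by
  change InnerProductGeometry.angle (a - b) (0 - b) = _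
  rw [zero_sub, InnerProductGeometry.angle_neg_right, InnerProductGeometry.angle_comm,
    angle_eq_arg_sub_arg hb hab h h']

/-- The bouncing path between two parallel opposite edges of a quadrilateral that is a rectangle. -/
lemma hasBasicPath_of_rectangle {a b : ℂ} (ha : a.re = 1) (hb : b.re = 0) (him : a.im = b.im)
    (hc : IsPositivelyConvex (quad a b)) : HasBasicPath (quad a b) := by
  have hba : b - a = -1 := by
    apply Complex.ext <;> simp [ha, hb, him]
  have h0 : bounce (quad a b) 0 ⟨-Complex.I, -(1 / 2)⟩ = ⟨Complex.I, 1 / 2⟩ := by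
    ext1
    · simp [bounce, edgeVec_quad_zero, mirror]
    · simp [bounce, quad, cross_zero_left]
  have h2 : bounce (quad a b) 2 ⟨Complex.I, 1 / 2⟩ = ⟨-Complex.I, -(1 / 2)⟩ := by
    have e : mirror (edgeVec (quad a b) 2) Complex.I = -Complex.I := by
      simp [edgeVec_quad_two, hba, mirror]
    ext1
    · exact e
    · simp [bounce, e, cross_neg_right]
  have l0 : Leaves (quad a b) 0 ⟨Complex.I, 1 / 2⟩ := by
    constructor
    · simp [quad, cross_zero_left]
    · simp only [quad, zero_add, Matrix.cons_val, cross_one_left, Complex.I_im]; norm_num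
  have l2 : Leaves (quad a b) 2 ⟨-Complex.I, -(1 / 2)⟩ := by
    constructor
    · change cross a (-Complex.I) < -(1 / 2)
      simp only [cross, Complex.neg_re, Complex.neg_im, Complex.I_re, Complex.I_im, ha]; norm_num
    · change -(1 / 2) < cross b (-Complex.I)
      simp only [cross, Complex.neg_re, Complex.neg_im, Complex.I_re, Complex.I_im, hb]; norm_num
  have hf : Follows (quad a b) ⟨-Complex.I, -(1 / 2)⟩ [0, 2] ⟨-Complex.I, -(1 / 2)⟩ :=
    Follows.step h0 l0 (Follows.step h2 l2 (Follows.nil _))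
  exact (hf.append hf).hasBasicPath (U := [0, 2, 0, 2]) hc (by simp [basicOrbitTypes])
    (by simp) (by decide) 0 (by decide)

/-- The bound `κ` must serve a whole neighbourhood of the rectangle, since the deviations of the
angles are afterwards made small in terms of it. A product neighbourhood provides it. -/
lemma exists_uniform_of_eventually {X : Type*} [TopologicalSpace X] {P : X → ℝ × ℝ → Prop} {x₀ : X}
    (h : ∀ᶠ z in 𝓝 (x₀, ((0 : ℝ), (0 : ℝ))), P z.1 z.2) :
    ∃ κ > 0, ∀ᶠ x in 𝓝 x₀, ∀ θ m : ℝ, |θ| ≤ κ → |m| ≤ κ → P x (θ, m) := by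
  rw [nhds_prod_eq] at h
  obtain ⟨pa, ha, pb, hb, hP⟩ := Filter.eventually_prod_iff.1 h
  obtain ⟨ε, hε, hball⟩ := Metric.eventually_nhds_iff.1 hb
  refine ⟨ε / 2, half_pos hε, ha.mono fun x hx θ m hθ hm => hP hx (hball ?_)⟩
  rw [Prod.dist_eq, Real.dist_eq, Real.dist_eq, sub_zero, sub_zero]
  exact (max_le hθ hm).trans_lt (half_lt_self hε)

/-- The properties of quadrilaterals near a rectangle from which the theorem is deduced. -/
structure IsNearlyRectangular (V : Fin 4 → ℂ) : Prop where
  convex : IsStrictlyConvex V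
  sum_angles : cornerAngle V 0 + cornerAngle V 1 + cornerAngle V 2 + cornerAngle V 3 = 2 * Real.pi
  path_of_acute : cornerAngle V 0 < Real.pi / 2 →
    (2 * (cornerAngle V 1 - Real.pi / 2) ≤ Real.pi / 2 - cornerAngle V 0 ∨
      cornerAngle V 2 < Real.pi / 2) → HasBasicPath V
  path_of_right : (∀ i, cornerAngle V i = Real.pi / 2) → HasBasicPath V

/-- The inequalities, stable under small perturbations, that make the frames of the paths work. -/
lemma eventually_far {h : ℝ} (hh : 0 < h) :
    ∃ κ > 0, ∀ᶠ x : ℂ × ℂ in 𝓝 (1 + h * Complex.I, h * Complex.I), ∀ θ m : ℝ, |θ| ≤ κ → |m| ≤ κ →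
      m < cross x.1 (-Complex.exp (θ * Complex.I)) ∧
      cross x.2 (Complex.exp (θ * Complex.I)) < m ∧
      Complex.normSq x.1 * m < cross 1 (x.1 * Complex.exp (θ * Complex.I)) ∧
      Complex.normSq x.1 * m < -cross (x.1 - 1) (x.1 * Complex.exp (θ * Complex.I)) ∧
      Complex.normSq x.1 * m < -cross (x.2 - x.1) (x.1 * Complex.exp (θ * Complex.I)) ∧
      Complex.normSq x.1 * m < -cross x.2 (x.1 * Complex.exp (θ * Complex.I)) := by
  refine exists_uniform_of_eventually (P := fun (x : ℂ × ℂ) (y : ℝ × ℝ) =>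
    y.2 < cross x.1 (-Complex.exp (y.1 * Complex.I)) ∧
      cross x.2 (Complex.exp (y.1 * Complex.I)) < y.2 ∧
      Complex.normSq x.1 * y.2 < cross 1 (x.1 * Complex.exp (y.1 * Complex.I)) ∧
      Complex.normSq x.1 * y.2 < -cross (x.1 - 1) (x.1 * Complex.exp (y.1 * Complex.I)) ∧
      Complex.normSq x.1 * y.2 < -cross (x.2 - x.1) (x.1 * Complex.exp (y.1 * Complex.I)) ∧
      Complex.normSq x.1 * y.2 < -cross x.2 (x.1 * Complex.exp (y.1 * Complex.I))) ?_
  simp only [Filter.eventually_and]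
  have hcross : ∀ {f g : (ℂ × ℂ) × (ℝ × ℝ) → ℂ}, Continuous f → Continuous g →
      Continuous fun z => cross (f z) (g z) := by
    intro f g hf hg
    unfold cross
    fun_prop
  have c1 : Continuous fun z : (ℂ × ℂ) × (ℝ × ℝ) => Complex.normSq z.1.1 * z.2.2 :=
    (Complex.continuous_normSq.comp (by fun_prop)).mul (by fun_prop)
  refine ⟨?_, ?_, ?_, ?_, ?_, ?_⟩
  · exact (Continuous.continuousAt (by fun_prop)).eventually_lt
      (hcross (by fun_prop) (by fun_prop)).continuousAt (by simpa [cross] using hh)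
  · exact (hcross (by fun_prop) (by fun_prop)).continuousAt.eventually_lt
      (Continuous.continuousAt (by fun_prop)) (by simpa [cross] using hh)
  · exact c1.continuousAt.eventually_lt
      (hcross (by fun_prop) (by fun_prop)).continuousAt (by simpa [cross] using hh)
  · exact c1.continuousAt.eventually_lt
      (hcross (by fun_prop) (by fun_prop)).neg.continuousAt (by simpa [cross] using hh)
  · exact c1.continuousAt.eventually_lt
      (hcross (by fun_prop) (by fun_prop)).neg.continuousAt (by simpa [cross] using hh)
  · exact c1.continuousAt.eventually_lt
      (hcross (by fun_prop) (by fun_prop)).neg.continuousAt (by simpa [cross] using hh)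

lemma eventually_isPositivelyConvex {h : ℝ} (hh : 0 < h) :
    ∀ᶠ x : ℂ × ℂ in 𝓝 (1 + h * Complex.I, h * Complex.I), IsPositivelyConvex (quad x.1 x.2) := by
  have e : ∀ x : ℂ × ℂ, IsPositivelyConvex (quad x.1 x.2) ↔ 0 < cross 1 (x.1 - 1) ∧
      0 < cross (x.1 - 1) (x.2 - x.1) ∧ 0 < cross (x.2 - x.1) (-x.2) ∧ 0 < cross (-x.2) 1 := by
    intro x
    rw [IsPositivelyConvex]
    constructor
    · intro h
      refine ⟨?_, ?_, ?_, ?_⟩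
      · simpa only [zero_add, edgeVec_quad_zero, edgeVec_quad_one] using h 0
      · simpa only [Fin.reduceAdd, edgeVec_quad_two, edgeVec_quad_one] using h 1
      · simpa only [Fin.reduceAdd, edgeVec_quad_two, edgeVec_quad_three] using h 2
      · simpa only [Fin.reduceAdd, edgeVec_quad_zero, edgeVec_quad_three] using h 3
    · rintro ⟨h0, h1, h2, h3⟩ i
      fin_cases i
      · change 0 < cross (edgeVec (quad x.1 x.2) 0) (edgeVec (quad x.1 x.2) 1)
        rwa [edgeVec_quad_zero, edgeVec_quad_one]
      · change 0 < cross (edgeVec (quad x.1 x.2) 1) (edgeVec (quad x.1 x.2) 2)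
        rwa [edgeVec_quad_one, edgeVec_quad_two]
      · change 0 < cross (edgeVec (quad x.1 x.2) 2) (edgeVec (quad x.1 x.2) 3)
        rwa [edgeVec_quad_two, edgeVec_quad_three]
      · change 0 < cross (edgeVec (quad x.1 x.2) 3) (edgeVec (quad x.1 x.2) 0)
        rwa [edgeVec_quad_three, edgeVec_quad_zero]
  simp only [e, Filter.eventually_and]
  have hcross : ∀ {f g : ℂ × ℂ → ℂ}, Continuous f → Continuous g →
      Continuous fun z => cross (f z) (g z) := by
    intro f g hf hg
    unfold cross
    fun_prop
  refine ⟨?_, ?_, ?_, ?_⟩ <;>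
    exact continuousAt_const.eventually_lt (hcross (by fun_prop) (by fun_prop)).continuousAt
      (by simpa [cross] using hh)

lemma eventually_isNearlyRectangular {h : ℝ} (hh : 0 < h) :
    ∀ᶠ x : ℂ × ℂ in 𝓝 (1 + h * Complex.I, h * Complex.I), IsNearlyRectangular (quad x.1 x.2) := by
  have hpi := Real.pi_gt_three
  obtain ⟨κ₀, hκ₀, hfar⟩ := eventually_far hh
  obtain ⟨κ, hκ, hκ1, hκ2⟩ : ∃ κ : ℝ, 0 < κ ∧ κ ≤ κ₀ ∧ κ ≤ 1 :=
    ⟨min κ₀ 1, lt_min hκ₀ one_pos, min_le_left _ _, min_le_right _ _⟩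
  set x₀ : ℂ × ℂ := (1 + h * Complex.I, h * Complex.I) with hx₀
  have hI : (h * Complex.I).arg = Real.pi / 2 := by
    rw [Complex.arg_real_mul _ hh, Complex.arg_I]
  -- Only now that `κ` is fixed are the angles restricted. The bound κ / 400 is more than enough for
  -- the κ / 200 and κ / 2 demanded by the paths.
  have hA : ∀ᶠ x in 𝓝 x₀, |Real.pi / 2 - x.2.arg| < κ / 400 := by
    have : ContinuousAt (fun x : ℂ × ℂ => |Real.pi / 2 - x.2.arg|) x₀ := by
      refine (continuousAt_const.sub
        (ContinuousAt.comp (Complex.continuousAt_arg ?_) continuousAt_snd)).abs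
      rw [Complex.mem_slitPlane_iff]
      right
      simpa [hx₀] using hh.ne'
    refine this.eventually_lt continuousAt_const ?_
    simp only [hx₀, hI, sub_self, abs_zero]
    positivity
  have hB : ∀ᶠ x in 𝓝 x₀, |Real.pi / 2 - (x.1 - 1).arg| < κ / 400 := by
    have : ContinuousAt (fun x : ℂ × ℂ => |Real.pi / 2 - (x.1 - 1).arg|) x₀ := by
      refine (continuousAt_const.sub (ContinuousAt.comp
        (g := Complex.arg) (Complex.continuousAt_arg ?_) (by fun_prop))).abs
      rw [Complex.mem_slitPlane_iff]
      right
      simpa [hx₀] using hh.ne'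
    refine this.eventually_lt continuousAt_const ?_
    simp only [hx₀, add_sub_cancel_left, hI, sub_self, abs_zero]
    positivity
  have hτ : ∀ᶠ x in 𝓝 x₀, |(x.1 - x.2).arg| < κ / 400 := by
    have : ContinuousAt (fun x : ℂ × ℂ => |(x.1 - x.2).arg|) x₀ := by
      refine (ContinuousAt.comp
        (g := Complex.arg) (Complex.continuousAt_arg ?_) (by fun_prop)).abs
      rw [Complex.mem_slitPlane_iff]
      left
      simp [hx₀]
    refine this.eventually_lt continuousAt_const ?_
    simp only [hx₀, add_sub_cancel_right, Complex.arg_one, abs_zero]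
    positivity
  have h1 : ∀ᶠ x in 𝓝 x₀, 0 < x.1.im :=
    continuousAt_const.eventually_lt (Continuous.continuousAt (by fun_prop))
      (by simpa [hx₀] using hh)
  have h2 : ∀ᶠ x in 𝓝 x₀, 0 < x.2.im :=
    continuousAt_const.eventually_lt (Continuous.continuousAt (by fun_prop))
      (by simpa [hx₀] using hh)
  have h3 : ∀ᶠ x in 𝓝 x₀, 0 < (x.1 - x.2).re :=
    continuousAt_const.eventually_lt (Continuous.continuousAt (by fun_prop)) (by simp [hx₀])
  filter_upwards [hfar, eventually_isPositivelyConvex hh, hA, hB, hτ, h1, h2, h3] with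
    ⟨a, b⟩ hfar hc hA hB hτ ha hb hab
  simp only at hfar hc hA hB hτ ha hb hab ⊢
  obtain ⟨A1, A2⟩ := abs_lt.1 hA
  obtain ⟨B1, B2⟩ := abs_lt.1 hB
  obtain ⟨T1, T2⟩ := abs_lt.1 hτ
  have c0 := cornerAngle_quad_zero (a := a) hb
  have c1 := cornerAngle_quad_one (b := b) ha
  have c2 := cornerAngle_quad_two ha hab (by linarith) (by linarith)
  have c3 := cornerAngle_quad_three hb hab (by linarith) (by linarith)
  have hb0 : b ≠ 0 := by rintro rfl; simp at hb
  have ha0 : a - 1 ≠ 0 := by intro h0; rw [sub_eq_zero.1 h0] at ha; simp at ha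
  have hab0 : a - b ≠ 0 := by intro h0; simp [h0] at hab
  refine ⟨hc.isStrictlyConvex, by rw [c0, c1, c2, c3]; ring, ?_, ?_⟩
  · rw [c0, c1, c2]
    rintro hA0 (hB0 | hC0)
    · have hf : IsFrame a b (Real.pi / 2 - b.arg) (Real.pi / 2 - (a - 1).arg) κ :=
        ⟨mirror_quad_three hb0, mirror_quad_one ha0,
          fun ψ m hψ hm => (hfar ψ m (hψ.trans hκ1) (hm.trans hκ1)).1,
          fun ψ m hψ hm => (hfar ψ m (hψ.trans hκ1) (hm.trans hκ1)).2.1, hc⟩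
      exact hf.hasBasicPath_of_two_mul_le (by linarith) (by linarith) (by linarith) (by linarith)
        hκ2
    · have hf : IsDiagonalFrame a b (Real.pi / 2 - b.arg) (Real.pi / 2 - (a - 1).arg)
          (a - b).arg κ :=
        ⟨mirror_quad_three hb0, mirror_quad_one ha0, mirror_quad_two hab0,
          fun ψ m hψ hm => (hfar ψ m (hψ.trans hκ1) (hm.trans hκ1)).2.2.1,
          fun ψ m hψ hm => (hfar ψ m (hψ.trans hκ1) (hm.trans hκ1)).2.2.2.1,
          fun ψ m hψ hm => (hfar ψ m (hψ.trans hκ1) (hm.trans hκ1)).2.2.2.2.1,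
          fun ψ m hψ hm => (hfar ψ m (hψ.trans hκ1) (hm.trans hκ1)).2.2.2.2.2, hc⟩
      exact hf.hasBasicPath (by linarith) (by linarith) (by linarith)
        (by rw [abs_le]; constructor <;> linarith) hκ2
  · intro hr
    have r0 := hr 0
    have r1 := hr 1
    have r2 := hr 2
    rw [c0] at r0
    rw [c1] at r1
    rw [c2] at r2
    have s0 := (Complex.arg_eq_pi_div_two_iff.1 r0).1
    have s1 := (Complex.arg_eq_pi_div_two_iff.1 (by linarith : (a - 1).arg = Real.pi / 2)).1
    have s2 := (Complex.arg_eq_zero_iff.1 (by linarith : (a - b).arg = 0)).2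
    rw [Complex.sub_re, Complex.one_re] at s1
    rw [Complex.sub_im] at s2
    exact hasBasicPath_of_rectangle (by linarith) s0 (by linarith) hc

/-! ### From normal position to arbitrary rectangles -/

lemma angle_conj_conj (x y : ℂ) :
    InnerProductGeometry.angle (conj x) (conj y) = InnerProductGeometry.angle x y :=
  Complex.conjLIE.toLinearIsometry.angle_map x y

lemma cornerAngle_of_similarityRelated {V V' : Fin 4 → ℂ} (h : SimilarityRelated V V')
    (i : Fin 4) : cornerAngle V' i = cornerAngle V i := by
  obtain ⟨c, t, hc, h | h⟩ := h
  · have : ∀ i j, V' i -ᵥ V' j = c * (V i - V j) := fun i j => by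
      rw [h, h, vsub_eq_sub]; ring
    simp only [cornerAngle, EuclideanGeometry.angle, this, Complex.angle_mul_left hc, vsub_eq_sub]
  · have : ∀ i j, V' i -ᵥ V' j = c * conj (V i - V j) := fun i j => by
      rw [h, h, vsub_eq_sub, map_sub]; ring
    simp only [cornerAngle, EuclideanGeometry.angle, this, Complex.angle_mul_left hc, vsub_eq_sub,
      angle_conj_conj]

lemma cornerAngle_rotate (V : Fin 4 → ℂ) (a i : Fin 4) :
    cornerAngle (fun j => V (a + j)) i = cornerAngle V (a + i) := by
  simp only [cornerAngle, add_sub_assoc, add_assoc]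

lemma cornerAngle_reflect (V : Fin 4 → ℂ) (a i : Fin 4) :
    cornerAngle (fun j => V (a + 1 - j)) i = cornerAngle V (a + 1 - i) := by
  have e1 : ∀ a i : Fin 4, a + 1 - (i - 1) = a + 1 - i + 1 := by decide
  have e2 : ∀ a i : Fin 4, a + 1 - (i + 1) = a + 1 - i - 1 := by decide
  simp only [cornerAngle, e1, e2]
  exact EuclideanGeometry.angle_comm _ _ _

lemma IsNearlyRectangular.of_similarityRelated {V V' : Fin 4 → ℂ} (h : SimilarityRelated V V')
    (hV : IsNearlyRectangular V) : IsNearlyRectangular V' := by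
  obtain ⟨h1, h2, h3, h4⟩ := hV
  have e := cornerAngle_of_similarityRelated h
  refine ⟨h1.of_similarityRelated h, ?_, ?_, ?_⟩
  · simpa only [e] using h2
  · simp only [e]
    exact fun h5 h6 => (h3 h5 h6).of_similarityRelated h
  · simp only [e]
    exact fun h5 => (h4 h5).of_similarityRelated h

lemma similarityRelated_quad {V : Fin 4 → ℂ} (h : V 0 ≠ V 1) :
    SimilarityRelated (quad ((V 2 - V 0) / (V 1 - V 0)) ((V 3 - V 0) / (V 1 - V 0))) V := by
  have h' : V 1 - V 0 ≠ 0 := sub_ne_zero.2 h.symm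
  refine ⟨V 1 - V 0, V 0, h', Or.inl fun i => ?_⟩
  fin_cases i <;> simp [quad, mul_div_cancel₀ _ h']

lemma similarityRelated_quad_conj {V : Fin 4 → ℂ} (h : V 0 ≠ V 1) :
    SimilarityRelated (quad (conj ((V 2 - V 0) / (V 1 - V 0)))
      (conj ((V 3 - V 0) / (V 1 - V 0)))) V := by
  have h' : V 1 - V 0 ≠ 0 := sub_ne_zero.2 h.symm
  have h'' : conj (V 1) - conj (V 0) ≠ 0 := by rwa [← map_sub, map_ne_zero]
  refine ⟨V 1 - V 0, V 0, h', Or.inr fun i => ?_⟩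
  fin_cases i <;> simp [quad, mul_div_cancel₀ _ h']

/-- A labelled rectangle. -/
def IsRectangleTuple (V : Fin 4 → ℂ) : Prop :=
  ∀ i, V i ≠ V (i + 1) ∧ cornerAngle V i = Real.pi / 2

lemma IsRectangleTuple.rotate {V : Fin 4 → ℂ} (hV : IsRectangleTuple V) (a : Fin 4) :
    IsRectangleTuple fun j => V (a + j) := by
  intro i
  rw [cornerAngle_rotate]
  beta_reduce
  rw [← add_assoc]
  exact hV _

lemma IsRectangleTuple.reflect {V : Fin 4 → ℂ} (hV : IsRectangleTuple V) (a : Fin 4) :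
    IsRectangleTuple fun j => V (a + 1 - j) := by
  intro i
  have e1 : a + 1 - i = a + 1 - (i + 1) + 1 :=
    (by decide : ∀ a i : Fin 4, a + 1 - i = a + 1 - (i + 1) + 1) a i
  rw [cornerAngle_reflect]
  refine ⟨?_, (hV _).2⟩
  beta_reduce
  rw [e1]
  exact (hV _).1.symm

lemma inner_eq_zero_of_cornerAngle {V : Fin 4 → ℂ} {i : Fin 4} (h : cornerAngle V i = Real.pi / 2) :
    (V (i - 1) - V i).re * (V (i + 1) - V i).re + (V (i - 1) - V i).im * (V (i + 1) - V i).im =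
      0 := by
  have := (InnerProductGeometry.inner_eq_zero_iff_angle_eq_pi_div_two _ _).2 h
  rw [vsub_eq_sub, vsub_eq_sub, Complex.inner] at this
  simp only [Complex.mul_re, Complex.conj_re, Complex.conj_im] at this
  linarith

/-- The right angles at vertices 0 and 1 fix the real parts, the one at vertex 2 equates the
heights. The sign of `h` is the orientation; a negative one is later removed by complex conjugation.
-/
lemma IsRectangleTuple.exists_height {V : Fin 4 → ℂ} (hV : IsRectangleTuple V) : ∃ h : ℝ, h ≠ 0 ∧
    (V 2 - V 0) / (V 1 - V 0) = 1 + h * Complex.I ∧ (V 3 - V 0) / (V 1 - V 0) = h * Complex.I := by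
  have hs := similarityRelated_quad (hV 0).1
  set a := (V 2 - V 0) / (V 1 - V 0) with ha
  set b := (V 3 - V 0) / (V 1 - V 0) with hb
  have hr : ∀ i, cornerAngle (quad a b) i = Real.pi / 2 := fun i => by
    rw [← cornerAngle_of_similarityRelated hs, (hV i).2]
  have h0 : (b - 0).re * ((1 : ℂ) - 0).re + (b - 0).im * ((1 : ℂ) - 0).im = 0 :=
    inner_eq_zero_of_cornerAngle (hr 0)
  have h1 : ((0 : ℂ) - 1).re * (a - 1).re + ((0 : ℂ) - 1).im * (a - 1).im = 0 :=
    inner_eq_zero_of_cornerAngle (V := quad a b) (i := 1) (hr 1)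
  have h2 : ((1 : ℂ) - a).re * (b - a).re + ((1 : ℂ) - a).im * (b - a).im = 0 :=
    inner_eq_zero_of_cornerAngle (V := quad a b) (i := 2) (hr 2)
  have ha1 : a ≠ 1 := by
    intro h
    have h' : V 1 - V 0 ≠ 0 := sub_ne_zero.2 (hV 0).1.symm
    rw [ha, div_eq_one_iff_eq h', sub_left_inj] at h
    exact (hV 1).1 h.symm
  simp only [Complex.sub_re, Complex.sub_im, Complex.one_re, Complex.one_im, Complex.zero_re,
    Complex.zero_im] at h0 h1 h2
  have hbre : b.re = 0 := by linarith
  have hare : a.re = 1 := by linarith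
  have haim : a.im ≠ 0 := fun h => ha1 (Complex.ext (by simpa using hare) (by simpa using h))
  have him : b.im = a.im := by
    rw [hare, sub_self, zero_mul, zero_add, zero_sub, neg_mul, neg_eq_zero, mul_eq_zero] at h2
    rcases h2 with h2 | h2
    · exact absurd h2 haim
    · linarith
  refine ⟨a.im, haim, ?_, ?_⟩ <;> apply Complex.ext <;> simp [hare, hbre, him]

lemma IsRectangleTuple.eventually_isNearlyRectangular {R : Fin 4 → ℂ} (hR : IsRectangleTuple R) :
    ∀ᶠ V in 𝓝 R, IsNearlyRectangular V := by
  obtain ⟨h, hh, e1, e2⟩ := hR.exists_height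
  have hne : ∀ᶠ V : Fin 4 → ℂ in 𝓝 R, V 0 ≠ V 1 :=
    (isOpen_ne_fun (continuous_apply 0) (continuous_apply 1)).mem_nhds (hR 0).1
  have hc : ContinuousAt (fun V : Fin 4 → ℂ =>
      ((V 2 - V 0) / (V 1 - V 0), (V 3 - V 0) / (V 1 - V 0))) R := by
    have h' : R 1 - R 0 ≠ 0 := sub_ne_zero.2 (hR 0).1.symm
    have hd : ∀ i j, ContinuousAt (fun V : Fin 4 → ℂ => V i - V j) R := fun i j => by fun_prop
    exact ((hd 2 0).div (hd 1 0) h').prodMk ((hd 3 0).div (hd 1 0) h')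
  rcases lt_or_gt_of_ne hh with hneg | hpos
  · have hc' : ContinuousAt (fun V : Fin 4 → ℂ =>
        (conj ((V 2 - V 0) / (V 1 - V 0)), conj ((V 3 - V 0) / (V 1 - V 0)))) R :=
      (Complex.continuous_conj.continuousAt.comp hc.fst).prodMk
        (Complex.continuous_conj.continuousAt.comp hc.snd)
    have ht := hc'.tendsto
    simp only [e1, e2, map_add, map_one, map_mul, Complex.conj_ofReal, Complex.conj_I] at ht
    have hev := QuadBilliard.eventually_isNearlyRectangular (h := -h) (by linarith)
    simp only [Complex.ofReal_neg, neg_mul, ← mul_neg] at hev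
    filter_upwards [ht.eventually hev, hne] with V hV hV'
    exact hV.of_similarityRelated (similarityRelated_quad_conj hV')
  · have ht := hc.tendsto
    simp only [e1, e2] at ht
    filter_upwards [ht.eventually (QuadBilliard.eventually_isNearlyRectangular hpos), hne] with
      V hV hV'
    exact hV.of_similarityRelated (similarityRelated_quad hV')

/-! ### Choosing the relabelling -/

/-- Near a rectangle, one of the eight relabellings of a quadrilateral has one of the paths
constructed above. -/
lemma hasBasicPath_of_relabellings {V : Fin 4 → ℂ}
    (h : ∀ a, IsNearlyRectangular fun j => V (a + j))
    (h' : ∀ a, IsNearlyRectangular fun j => V (a + 1 - j)) : HasBasicPath V := by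
  by_cases hr : ∀ i, cornerAngle V i = Real.pi / 2
  · exact ((h 0).path_of_right fun i => by rw [cornerAngle_rotate, hr]).rotate 0
  have hs := fun i => (h i).sum_angles
  simp only [cornerAngle_rotate, add_zero] at hs
  obtain ⟨i, hi⟩ : ∃ i, cornerAngle V i < Real.pi / 2 := by
    by_contra! hge
    apply hr
    intro i
    have := hs i
    linarith [hge i, hge (i + 1), hge (i + 2), hge (i + 3)]
  have hp := (h i).path_of_acute
  have hp' := (h' (i - 1)).path_of_acute
  simp only [cornerAngle_rotate, cornerAngle_reflect, add_zero] at hp hp'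
  simp only [sub_add_cancel, sub_zero] at hp'
  have e : i - 1 = i + 3 := (by decide : ∀ i : Fin 4, i - 1 = i + 3) i
  by_cases h1 : 2 * (cornerAngle V (i + 1) - Real.pi / 2) ≤ Real.pi / 2 - cornerAngle V i ∨
      cornerAngle V (i + 2) < Real.pi / 2
  · exact (hp hi h1).rotate i
  by_cases h2 : 2 * (cornerAngle V (i - 1) - Real.pi / 2) ≤ Real.pi / 2 - cornerAngle V i
  -- The relabelling `j ↦ i - j` keeps vertex `i` in place 0 and moves vertex `i - 1` to place 1.
  · refine HasBasicPath.reflect (i - 1) ?_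
    rw [sub_add_cancel]
    exact hp' hi (Or.inl h2)
  push Not at h1 h2
  rw [e] at h2
  -- Both neighbours would exceed π/2 by more than half the deficit at `i`, and the opposite angle
  -- is not acute, so the angles would add up to more than 2π.
  linarith [hs i, h1.1, h1.2]

lemma IsRectangleTuple.eventually_hasBasicPath {R : Fin 4 → ℂ} (hR : IsRectangleTuple R) :
    ∀ᶠ V in 𝓝 R, IsStrictlyConvex V ∧ HasBasicPath V := by
  have h1 : ∀ᶠ V : Fin 4 → ℂ in 𝓝 R, ∀ a : Fin 4, IsNearlyRectangular fun j => V (a + j) :=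
    Filter.eventually_all.2 fun a => by
      have hc : Continuous fun (V : Fin 4 → ℂ) (j : Fin 4) => V (a + j) := by fun_prop
      exact hc.continuousAt.eventually (hR.rotate a).eventually_isNearlyRectangular
  have h2 : ∀ᶠ V : Fin 4 → ℂ in 𝓝 R, ∀ a : Fin 4, IsNearlyRectangular fun j => V (a + 1 - j) :=
    Filter.eventually_all.2 fun a => by
      have hc : Continuous fun (V : Fin 4 → ℂ) (j : Fin 4) => V (a + 1 - j) := by fun_prop
      exact hc.continuousAt.eventually (hR.reflect a).eventually_isNearlyRectangular
  filter_upwards [hR.eventually_isNearlyRectangular, h1, h2] with V h0 h1 h2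
  exact ⟨h0.convex, hasBasicPath_of_relabellings h1 h2⟩

/-! ### Similarity classes and the quotient topology -/

lemma SimilarityRelated.exists_continuous {V V' : Fin 4 → ℂ} (h : SimilarityRelated V V') :
    ∃ g : (Fin 4 → ℂ) → Fin 4 → ℂ, Continuous g ∧ g V' = V ∧ ∀ w, SimilarityRelated (g w) w := by
  obtain ⟨c, t, hc, h | h⟩ := h
  · refine ⟨fun w i => c⁻¹ * (w i - t), by fun_prop, ?_, fun w => ⟨c, t, hc, Or.inl fun i => ?_⟩⟩
    · funext i
      simp [h, hc]
    · simp [hc]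
  · refine ⟨fun w i => conj (c⁻¹ * (w i - t)), ?_, ?_, fun w => ⟨c, t, hc, Or.inr fun i => ?_⟩⟩
    · exact continuous_pi fun i => Complex.continuous_conj.comp (by fun_prop)
    · funext i
      simp [h, hc]
    · simp [hc]

/-- The similarity carrying one tuple to the other acts on all nearby tuples too, so a neighbourhood
inside an invariant set can be pulled back along it. -/
lemma SimilarityRelated.mem_interior {V V' : Fin 4 → ℂ} (h : SimilarityRelated V V')
    {G : Set (Fin 4 → ℂ)} (hG : ∀ w w', SimilarityRelated w w' → w ∈ G → w' ∈ G)
    (hV : V ∈ interior G) : V' ∈ interior G := by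
  obtain ⟨g, hg, hgV, hgw⟩ := h.exists_continuous
  refine _root_.mem_interior.2 ⟨g ⁻¹' interior G, fun w hw => hG _ _ (hgw w) (interior_subset hw),
    isOpen_interior.preimage hg, ?_⟩
  rwa [Set.mem_preimage, hgV]

lemma re_eq_and_im_sq_eq {z w : ℂ} (h0 : ‖z‖ = ‖w‖) (h1 : ‖z - 1‖ = ‖w - 1‖) :
    z.re = w.re ∧ z.im * z.im = w.im * w.im := by
  have e0 : Complex.normSq z = Complex.normSq w := by
    rw [Complex.normSq_eq_norm_sq, Complex.normSq_eq_norm_sq, h0]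
  have e1 : Complex.normSq (z - 1) = Complex.normSq (w - 1) := by
    rw [Complex.normSq_eq_norm_sq, Complex.normSq_eq_norm_sq, h1]
  simp only [Complex.normSq_apply, Complex.sub_re, Complex.sub_im, Complex.one_re,
    Complex.one_im] at e0 e1
  have : z.re = w.re := by linarith
  refine ⟨this, ?_⟩
  rw [this] at e0
  linarith

/-- A figure of points containing `0` and `1` is determined up to complex conjugation by the
distances of its points. -/
lemma eq_or_eq_conj_of_norm_sub_eq {ι : Type*} {u w : ι → ℂ} (h0 : ∀ i, ‖u i‖ = ‖w i‖)
    (h1 : ∀ i, ‖u i - 1‖ = ‖w i - 1‖) (h : ∀ i j, ‖u i - u j‖ = ‖w i - w j‖) :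
    (∀ i, w i = u i) ∨ ∀ i, w i = conj (u i) := by
  have hr := fun i => (re_eq_and_im_sq_eq (h0 i) (h1 i)).1
  have hi := fun i => (re_eq_and_im_sq_eq (h0 i) (h1 i)).2
  have hij : ∀ i j, (u i).im * (u j).im = (w i).im * (w j).im := by
    intro i j
    have e : Complex.normSq (u i - u j) = Complex.normSq (w i - w j) := by
      rw [Complex.normSq_eq_norm_sq, Complex.normSq_eq_norm_sq, h]
    simp only [Complex.normSq_apply, Complex.sub_re, Complex.sub_im, hr] at e
    linarith [hi i, hi j]
  -- Each imaginary part is known up to sign, and by `hij` one point off the real axis fixes a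
  -- common sign for all.
  by_cases hu : ∃ k, (u k).im ≠ 0
  · obtain ⟨k, hk⟩ := hu
    rcases mul_self_eq_mul_self_iff.1 (hi k) with e | e
    · refine Or.inl fun i => Complex.ext (hr i).symm ?_
      have := hij k i
      rw [← e] at this
      exact (mul_left_cancel₀ hk this).symm
    · refine Or.inr fun i => Complex.ext (by simpa using (hr i).symm) ?_
      have := hij k i
      rw [e, neg_mul, ← mul_neg] at this
      have hk' : (w k).im ≠ 0 := by
        intro h0
        rw [h0, neg_zero] at e
        exact hk e
      rw [Complex.conj_im, ← mul_left_cancel₀ hk' this]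
  · push Not at hu
    refine Or.inl fun i => Complex.ext (hr i).symm ?_
    have := hi i
    rw [hu i, mul_zero] at this
    rw [hu i]
    exact mul_self_eq_zero.1 this.symm

/-- Dividing by the first edge places vertices 0 and 1 of both figures at 0 and 1 and makes all
corresponding distances equal, so the figures agree up to conjugation. -/
lemma similarityRelated_of_similar {V V' : Fin 4 → ℂ} (h : V ∼ V') (hV : V 0 ≠ V 1) :
    SimilarityRelated V V' := by
  obtain ⟨r, hr, h⟩ := h
  have hd : ∀ i j, ‖V i - V j‖ = r * ‖V' i - V' j‖ := by
    intro i j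
    have := congrArg ENNReal.toReal (h i j)
    rwa [ENNReal.toReal_mul, ENNReal.coe_toReal, ← dist_edist, ← dist_edist, dist_eq_norm,
      dist_eq_norm] at this
  have hr' : (r : ℝ) ≠ 0 := by exact_mod_cast hr
  have h10 : V 1 - V 0 ≠ 0 := sub_ne_zero.2 hV.symm
  have h10' : V' 1 - V' 0 ≠ 0 := by
    intro h0
    have := hd 1 0
    rw [h0, norm_zero, mul_zero, norm_eq_zero] at this
    exact h10 this
  have hn : ∀ i j, ‖(V i - V j) / (V 1 - V 0)‖ = ‖(V' i - V' j) / (V' 1 - V' 0)‖ := by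
    intro i j
    rw [norm_div, norm_div, hd, hd 1 0, mul_div_mul_left _ _ hr']
  have hsub : ∀ (V : Fin 4 → ℂ) (i j : Fin 4), (V i - V 0) / (V 1 - V 0) - (V j - V 0) / (V 1 - V 0)
      = (V i - V j) / (V 1 - V 0) := fun V i j => by rw [← sub_div, sub_sub_sub_cancel_right]
  have hV1 := div_self h10
  have hV1' := div_self h10'
  have hor := eq_or_eq_conj_of_norm_sub_eq (u := fun i => (V i - V 0) / (V 1 - V 0))
    (w := fun i => (V' i - V' 0) / (V' 1 - V' 0)) (fun i => hn i 0)
    (fun i => by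
      have := hn i 1
      rw [← hsub V i 1, ← hsub V' i 1, hV1, hV1'] at this
      exact this)
    (fun i j => by simp only [hsub, hn])
  rcases hor with e | e
  · refine ⟨(V' 1 - V' 0) / (V 1 - V 0), V' 0 - (V' 1 - V' 0) / (V 1 - V 0) * V 0,
      div_ne_zero h10' h10, Or.inl fun i => ?_⟩
    have := e i
    rw [div_eq_iff h10'] at this
    linear_combination this
  · have h10c : conj (V 1 - V 0) ≠ 0 := (map_ne_zero _).2 h10
    refine ⟨(V' 1 - V' 0) / conj (V 1 - V 0),
      V' 0 - (V' 1 - V' 0) / conj (V 1 - V 0) * conj (V 0), div_ne_zero h10' h10c,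
      Or.inr fun i => ?_⟩
    have := e i
    rw [div_eq_iff h10', map_div₀, map_sub conj (V i)] at this
    linear_combination this

namespace Quadrilateral

lemma apply_ne_apply_add_one (P : Quadrilateral) (i : Fin 4) : P.1 i ≠ P.1 (i + 1) := by
  intro h
  apply P.2.1 i
  rw [← h, Set.insert_eq_of_mem (Set.mem_insert _ _)]
  exact collinear_pair ℝ _ _

lemma similarityRelated {P Q : Quadrilateral} (h : (⟦P⟧ : QuadSpace) = ⟦Q⟧) :
    SimilarityRelated P.1 Q.1 :=
  similarityRelated_of_similar (Quotient.exact h) (P.apply_ne_apply_add_one 0)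

lemma IsRectangle.isRectangleTuple {P : Quadrilateral} (h : P.IsRectangle) :
    IsRectangleTuple P.1 := by
  intro i
  refine ⟨P.apply_ne_apply_add_one i, ?_⟩
  have := h (i - 1)
  rwa [sub_add_cancel, (by decide : ∀ i : Fin 4, i - 1 + 2 = i + 1) i] at this

lemma HasOrbitType.hasPeriodicBilliardPath {P : Quadrilateral} {W : List (Fin 4)}
    (h : P.HasOrbitType W) : P.HasPeriodicBilliardPath := by
  obtain ⟨hW, -, s, p, hp, hper, -⟩ := h
  exact ⟨s, p, W.length, List.length_pos_of_ne_nil hW, hp, hper⟩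

end Quadrilateral

/-- The finite set of all relabellings of the basic words. -/
def relabelledWords : Finset (List (Fin 4)) :=
  basicOrbitTypes.toFinset.biUnion fun V =>
    Finset.univ.image (fun a : Fin 4 => V.map fun i => a + i) ∪
      Finset.univ.image (fun a : Fin 4 => V.map fun i => a - i)

lemma mem_relabelledWords {W : List (Fin 4)} :
    W ∈ relabelledWords ↔ ∃ V ∈ basicOrbitTypes, IsRelabelling W V := by
  simp only [relabelledWords, Finset.mem_biUnion, List.mem_toFinset, Finset.mem_union,
    Finset.mem_image, Finset.mem_univ, true_and, IsRelabelling, exists_or, eq_comm]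

/-- The strictly convex labelled quadrilaterals that have one of the basic paths. -/
def goodTuples : Set (Fin 4 → ℂ) := {V | IsStrictlyConvex V ∧ HasBasicPath V}

lemma mem_goodTuples_of_similarityRelated {V V' : Fin 4 → ℂ} (h : SimilarityRelated V V')
    (hV : V ∈ goodTuples) : V' ∈ goodTuples :=
  ⟨hV.1.of_similarityRelated h, hV.2.of_similarityRelated h⟩

/-- The similarity classes in the interior of the set of good quadrilaterals. -/
def goodClasses : Set QuadSpace :=
  {q | ∃ P : Quadrilateral, (⟦P⟧ : QuadSpace) = q ∧ P.1 ∈ interior goodTuples}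

/-- Openness in the quotient means openness of the preimage. As the interior of the good tuples is
invariant under similarity, this preimage is just its trace on the quadrilaterals. -/
lemma isOpen_goodClasses : IsOpen goodClasses := by
  have e : (Quotient.mk _ : Quadrilateral → QuadSpace) ⁻¹' goodClasses =
      Subtype.val ⁻¹' interior goodTuples := by
    ext Q
    constructor
    · rintro ⟨P, hPQ, hP⟩
      exact (Quadrilateral.similarityRelated hPQ).mem_interior
        (fun _ _ => mem_goodTuples_of_similarityRelated) hP
    · exact fun hQ => ⟨Q, rfl, hQ⟩
  refine isOpen_coinduced.2 ?_
  change IsOpen ((Quotient.mk _ : Quadrilateral → QuadSpace) ⁻¹' goodClasses)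
  rw [e]
  exact isOpen_interior.preimage continuous_subtype_val

lemma rectangles_subset_goodClasses : rectangles ⊆ goodClasses := by
  rintro _ ⟨P, hP, rfl⟩
  exact ⟨P, rfl, mem_interior_iff_mem_nhds.2 hP.isRectangleTuple.eventually_hasBasicPath⟩

lemma goodClasses_subset : goodClasses ⊆ ⋃ W ∈ relabelledWords, orbitTile W := by
  rintro _ ⟨P, rfl, hP⟩
  obtain ⟨hc, U, hU, W, hW, hb⟩ := interior_subset hP
  refine Set.mem_iUnion₂.2 ⟨W, mem_relabelledWords.2 ⟨U, hU, hW⟩, fun Q hQ => ?_⟩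
  have hs := Quadrilateral.similarityRelated hQ.symm
  exact (hb.of_similarityRelated hs).hasOrbitType (hc.of_similarityRelated hs)

end QuadBilliard

theorem theorem1 :
    (∀ r ∈ QuadBilliard.rectangles, ∃ U : Set QuadBilliard.QuadSpace, IsOpen U ∧ r ∈ U ∧
      ∀ P : QuadBilliard.Quadrilateral, (⟦P⟧ : QuadBilliard.QuadSpace) ∈ U →
        P.HasPeriodicBilliardPath) ∧
    (∃ U : Set QuadBilliard.QuadSpace, IsOpen U ∧ QuadBilliard.rectangles ⊆ U ∧
      ∃ F : Finset (List (Fin 4)),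
        (∀ W ∈ F, ∃ V ∈ QuadBilliard.basicOrbitTypes, QuadBilliard.IsRelabelling W V) ∧
        U ⊆ ⋃ W ∈ F, QuadBilliard.orbitTile W) := by
  open QuadBilliard in
  refine ⟨fun r hr => ⟨goodClasses, isOpen_goodClasses, rectangles_subset_goodClasses hr,
    fun P hP => ?_⟩, goodClasses, isOpen_goodClasses, rectangles_subset_goodClasses,
    relabelledWords, fun W => mem_relabelledWords.1, goodClasses_subset⟩
  obtain ⟨W, -, hW⟩ := Set.mem_iUnion₂.1 (QuadBilliard.goodClasses_subset hP)
  exact (hW P rfl).hasPeriodicBilliardPath
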